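/- Let $\xi$ be a random variable with values in $\{0,1,2,\dots\}$ such that $\mathbb E\,\xi=1$ and $0<\sigma^2:=\operatorname{Var}\xi<\infty$. Let $\mathcal T$ be the Galton--Watson tree with offspring distribution $\xi$, regarded as a random finite rooted ordered tree (it is almost surely finite), and for each $n$ with $\mathbb P(|\mathcal T|=n)>0$ let $\mathcal T_n$ be the conditioned Galton--Watson tree, that is, $\mathcal T$ conditioned on having exactly $n$ nodes. Below, $n$ ranges only over such values, and $O(\cdot)$ refers to $n\to\infty$ through them. Let $f$ be a real-valued function on the set of finite rooted ordered trees such that $\mathbb E|f(\mathcal T)|<\infty$, put $\mu:=\mathbb E f(\mathcal T)$, and let $$F(T):=\sum_{v\in T}f(T_v),$$ where $T_v$ is the subtree of $T$ consisting of the node $v$ and all its descendants. Suppose that $\mathbb E f(\mathcal T_n)\to0$ as $n\to\infty$. (a) If $0<\delta<1$, $\mathbb E\,\xi^{2+\delta}<\infty$ and $\mathbb E f(\mathcal T_n)=O(n^{-\delta/2})$, then $$\mathbb E F(\mathcal T_n)=n\mu+O\bigl(n^{(1-\delta)/2}\bigr).$$ (b) If $\mathbb E\,\xi^3<\infty$,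 $\mathbb E f(\mathcal T_n)=O(n^{-1/2})$ and $\sum_{n}|\mathbb E f(\mathcal T_n)|\,n^{-1/2}<\infty$, then $$\mathbb E F(\mathcal T_n)=n\mu+O(1).$$ -/

import Mathlib

open MeasureTheory ProbabilityTheory Filter Topology Asymptotics

/-- Finite rooted ordered (plane) trees: a root together with the ordered list of its branches. -/
inductive PlaneTree : Type where
  | node : List PlaneTree → PlaneTree

namespace PlaneTree

/-- The number of nodes `|T|`. -/
def size : PlaneTree → ℕ
  | node ts => 1 + (ts.map size).sum

/-- The list of all fringe subtrees `T_v`, one entry for each node `v` of `T`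
(in depth-first order): the whole tree for the root, then those of the nodes in the branches. -/
def fringe : PlaneTree → List PlaneTree
  | node ts => node ts :: ts.flatMap fringe

/-- The additive functional `F(T) = ∑_{v ∈ T} f(T_v)` with toll function `f`. -/
def additive (f : PlaneTree → ℝ) (t : PlaneTree) : ℝ :=
  (t.fringe.map f).sum

/-- The probability that the Galton–Watson tree with offspring distribution `ν` equals a given
finite tree: the root has the right number of children, and the branches, being independent
copies of the Galton–Watson tree, are the given ones. Hence it is the product of
`ν {number of children of v}` over all nodes `v`. -/
noncomputable def gwWeight (ν : Measure ℕ) : PlaneTree → ENNReal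
  | node ts => ν {ts.length} * (ts.map (gwWeight ν)).prod

instance : MeasurableSpace PlaneTree := ⊤

/-- The law, on the set of finite plane trees, of the Galton–Watson tree `𝒯` with offspring
distribution `ν`. (In the critical case `𝒯` is almost surely finite.) -/
noncomputable def gwLaw (ν : Measure ℕ) : Measure PlaneTree :=
  Measure.sum fun t => gwWeight ν t • Measure.dirac t

/-- The law of the conditioned Galton–Watson tree `𝒯_n`, that is, of `𝒯` given `|𝒯| = n`. -/
noncomputable def condGW (ν : Measure ℕ) (n : ℕ) : Measure PlaneTree :=
  ProbabilityTheory.cond (gwLaw ν) {t | t.size = n}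

/-- The sizes `n` with `P(|𝒯| = n) > 0`, for which `𝒯_n` is defined. -/
def admissible (ν : Measure ℕ) : Set ℕ :=
  {n | 0 < gwLaw ν {t | t.size = n}}

/-- The limit `n → ∞` along the sizes `n` with `P(|𝒯| = n) > 0`. -/
def admissibleAtTop (ν : Measure ℕ) : Filter ℕ :=
  atTop ⊓ 𝓟 (admissible ν)

end PlaneTree

/-!
Write `g k = E[f(𝒯); |𝒯| = k]` and let `S_n` be the sum of `n` independent offspring numbers.

**Exact formula.** Deleting the root of the first tree of a plane forest, while remembering its
number of children, is a bijection. It turns the total weight of forests with `n` nodes and `r`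
trees into a solution of the recursion satisfied by `(r / n) P(S_n = n - r)`; for `r = 1` this is
the Otter–Dwass formula `n P(|𝒯| = n) = P(S_n = n - 1)` (`PlaneTree.mul_treeMean_one`). The same
recursion, carried along with the additive functional, gives
`E[F(𝒯); |𝒯| = n] = ∑_{k ≤ n} g k * P(S_{n-k} = n - k)` (`PlaneTree.treeMean_additive`). Hence
`E F(𝒯_n) - n μ` equals
`n / P(S_n = n - 1) * ∑_{k ≤ n} g k * (P(S_{n-k} = n - k) - P(S_n = n - 1)) - n * ∑_{k > n} g k`.

**Local limit estimates.** Let `h` be the span of the offspring law and `ψ` the characteristic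
function of `ξ - 1`. Fourier inversion on `[-π/h, π/h]` expresses `P(S_n = n - j)` as an integral
of `ψ(t) ^ n * exp (ijt)`. On this interval `|ψ(t)| ≤ exp (-c t²)`, and a moment of order `2 + δ`
gives `ψ(t) = exp (-σ² t² / 2) + O(|t| ^ (2 + δ))`. It follows that `P(S_n = n - 1)` has order
`n ^ (-1/2)`, and that
`P(S_{n-k} = n - k) - P(S_n = n - 1) = O(k n ^ (-3/2) + n ^ (-1 - δ/2))` for `k ≤ n / 2`.
In the second bound, integrating `|1 - exp (it)|` against `exp (-c n t²)` would give only
`n ^ (-1)`. The real part of `1 - exp (it)` is quadratic in `t`, and the imaginary part is odd, so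
against `ψ ^ n` only the deviation of `ψ ^ n` from the Gaussian contributes to it
(`LocalLimit.exists_abs_fourier_sub_le`, `PlaneTree.exists_walkProb_bounds`).

**Conclusion.** By the Otter–Dwass formula `g k = O(k ^ (-3/2 - δ/2))`. Inserting the estimates into
the exact formula, the indices `k ≤ n / 2`, `n / 2 < k ≤ n` and `k > n` each contribute
`O(n ^ ((1 - δ) / 2))`, provided that `∑_{k ≤ n} k |g k|` is of this order
(`PlaneTree.exists_abs_convolution_sub_le`). For `δ < 1` this holds by the decay of `g`; for `δ = 1`
it is the summability hypothesis of the second part.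
-/

namespace PlaneTree

/-! ### Forests of given size -/

lemma size_node (ts : List PlaneTree) : (node ts).size = 1 + (ts.map size).sum := by
  rw [size]

lemma additive_node (f : PlaneTree → ℝ) (ts : List PlaneTree) :
    additive f (node ts) = f (node ts) + (ts.map (additive f)).sum := by
  rw [additive, fringe, List.map_cons, List.sum_cons]
  congr 1
  induction ts with
  | nil => simp
  | cons t ts ih => simp [ih, additive]

lemma size_pos (t : PlaneTree) : 0 < t.size := by
  cases t with
  | node ts => rw [size_node]; omega

lemma length_le_sum_size (L : List PlaneTree) : L.length ≤ (L.map size).sum := by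
  induction L with
  | nil => simp
  | cons t L ih => have := size_pos t; simp; omega

lemma finite_forests (n : ℕ) : {L : List PlaneTree | (L.map size).sum = n}.Finite := by
  induction n with
  | zero =>
    refine (Set.finite_singleton []).subset fun L hL => ?_
    have := length_le_sum_size L
    rw [Set.mem_ofPred_eq] at hL
    exact List.length_eq_zero_iff.mp (by omega)
  | succ n ih =>
    refine ((ih.prod (Set.finite_Iic n)).image
      (fun x => node (x.1.take x.2) :: x.1.drop x.2)).subset ?_
    rintro (_ | ⟨⟨ts⟩, R⟩) hL
    · simp at hL
    · simp only [Set.mem_ofPred_eq, List.map_cons, List.sum_cons, size_node] at hL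
      have := length_le_sum_size ts
      refine ⟨(ts ++ R, ts.length), ⟨?_, ?_⟩, ?_⟩
      · simp; omega
      · simp; omega
      · simp

/-- The finite set of plane forests with `n` nodes and `r` trees. -/
noncomputable def forests (n r : ℕ) : Finset (List PlaneTree) :=
  ((finite_forests n).inter_of_left {L | L.length = r}).toFinset

lemma mem_forests {n r : ℕ} {L : List PlaneTree} :
    L ∈ forests n r ↔ (L.map size).sum = n ∧ L.length = r := by
  simp [forests]

lemma finite_trees (n : ℕ) : {t : PlaneTree | t.size = n}.Finite := by
  refine ((finite_forests n).preimage (f := fun t => [t]) (by intro a _ b _; simp)).subset ?_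
  intro t ht
  simpa using ht

/-- The finite set of plane trees with `n` nodes. -/
noncomputable def trees (n : ℕ) : Finset PlaneTree := (finite_trees n).toFinset

lemma mem_trees {n : ℕ} {t : PlaneTree} : t ∈ trees n ↔ t.size = n := by
  simp [trees]

lemma forests_zero_right {n : ℕ} (hn : n ≠ 0) : forests n 0 = ∅ := by
  ext L
  simp only [mem_forests, List.length_eq_zero_iff, Finset.notMem_empty, iff_false]
  rintro ⟨h, rfl⟩
  simp at h
  omega

lemma forests_zero_zero : forests 0 0 = {[]} := by
  ext L
  simp only [mem_forests, List.length_eq_zero_iff, Finset.mem_singleton]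
  constructor
  · exact fun h => h.2
  · rintro rfl; simp

lemma forests_eq_empty {n r : ℕ} (h : n < r) : forests n r = ∅ := by
  ext L
  have := length_le_sum_size L
  simp only [mem_forests, Finset.notMem_empty, iff_false]
  omega

/-- The forest obtained by deleting the root of the first tree. -/
def removeRoot : List PlaneTree → List PlaneTree
  | [] => []
  | node ts :: R => ts ++ R

/-- Deleting the root of the first tree, while remembering its number of children `i`, is a
bijection. -/
lemma sum_forests_succ (n r N : ℕ) (hN : n < N) (H : List PlaneTree → ℝ) :
    ∑ L ∈ forests (n + 1) (r + 1), H L =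
      ∑ i ∈ Finset.range N, ∑ L ∈ forests n (r + i), H (node (L.take i) :: L.drop i) := by
  rw [Finset.sum_sigma']
  symm
  refine Finset.sum_bij (fun x _ => node (x.2.take x.1) :: x.2.drop x.1) ?_ ?_ ?_ ?_
  · rintro ⟨i, L⟩ hx
    simp only [Finset.mem_sigma, Finset.mem_range, mem_forests] at hx
    obtain ⟨-, h1, h2⟩ := hx
    rw [mem_forests]
    constructor
    · rw [← h1]
      conv_rhs => rw [← List.take_append_drop i L, List.map_append, List.sum_append]
      simp only [List.map_cons, List.sum_cons, size_node]
      omega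
    · simp [h2]
  · rintro ⟨i, L⟩ hx ⟨j, L'⟩ hy h
    simp only [Finset.mem_sigma, Finset.mem_range, mem_forests] at hx hy
    simp only [List.cons.injEq, node.injEq] at h
    have hL : L = L' := by
      rw [← List.take_append_drop i L, h.1, h.2, List.take_append_drop]
    subst hL
    have : i = j := by omega
    subst this
    rfl
  · rintro (_ | ⟨⟨ts⟩, R⟩) hL
    · simp [mem_forests] at hL
    · simp only [mem_forests, List.map_cons, List.sum_cons, size_node, List.length_cons] at hL
      have := length_le_sum_size ts
      refine ⟨⟨ts.length, ts ++ R⟩, ?_, ?_⟩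
      · simp only [Finset.mem_sigma, Finset.mem_range, mem_forests, List.map_append,
          List.sum_append, List.length_append]
        omega
      · simp
  · rintro ⟨i, L⟩ _
    rfl

/-- A nonempty forest is its first tree together with the remaining forest. -/
lemma sum_forests_cons (n r : ℕ) (H : List PlaneTree → ℝ) :
    ∑ L ∈ forests n (r + 1), H L =
      ∑ x ∈ Finset.HasAntidiagonal.antidiagonal n, ∑ t ∈ trees x.1, ∑ R ∈ forests x.2 r, H (t :: R) := by
  simp_rw [← Finset.sum_product']
  rw [Finset.sum_sigma']
  symm
  refine Finset.sum_bij (fun x _ => x.2.1 :: x.2.2) ?_ ?_ ?_ ?_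
  · rintro ⟨⟨j, m⟩, t, R⟩ hx
    simp only [Finset.mem_sigma, Finset.HasAntidiagonal.mem_antidiagonal, Finset.mem_product, mem_trees,
      mem_forests] at hx
    simp only [mem_forests, List.map_cons, List.sum_cons, List.length_cons]
    omega
  · rintro ⟨⟨j, m⟩, t, R⟩ hx ⟨⟨j', m'⟩, t', R'⟩ hy h
    simp only [Finset.mem_sigma, Finset.HasAntidiagonal.mem_antidiagonal, Finset.mem_product, mem_trees,
      mem_forests] at hx hy
    simp only [List.cons.injEq] at h
    obtain ⟨rfl, rfl⟩ := h
    obtain ⟨-, rfl, rfl, -⟩ := hx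
    obtain ⟨-, rfl, rfl, -⟩ := hy
    rfl
  · rintro (_ | ⟨t, R⟩) hL
    · simp [mem_forests] at hL
    · simp only [mem_forests, List.map_cons, List.sum_cons, List.length_cons] at hL
      refine ⟨⟨(t.size, (R.map size).sum), t, R⟩, ?_, rfl⟩
      simp only [Finset.mem_sigma, Finset.HasAntidiagonal.mem_antidiagonal, Finset.mem_product, mem_trees,
        mem_forests]
      exact ⟨hL.1, trivial, trivial, by omega⟩
  · rintro ⟨⟨j, m⟩, t, R⟩ _
    rfl

/-! ### Walk probabilities and the weights of forests -/

/-- The probability generating function of the offspring distribution, as a formal power series. -/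
noncomputable def offspringSeries (ν : Measure ℕ) : PowerSeries ℝ :=
  PowerSeries.mk fun k => ν.real {k}

/-- The probability that the sum of `n` independent offspring numbers equals `s`, encoded as a
coefficient of the `n`-th power of the generating function. -/
noncomputable def walkProb (ν : Measure ℕ) (n s : ℕ) : ℝ :=
  PowerSeries.coeff s (offspringSeries ν ^ n)

lemma walkProb_succ (ν : Measure ℕ) (n s : ℕ) :
    walkProb ν (n + 1) s =
      ∑ x ∈ Finset.HasAntidiagonal.antidiagonal s, ν.real {x.1} * walkProb ν n x.2 := by
  rw [walkProb, pow_succ', PowerSeries.coeff_mul]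
  simp [offspringSeries, walkProb]

/-- By exchangeability, each of `n + 1` summands has mean `s / (n + 1)` on the event that the sum
is `s`. -/
lemma sum_antidiagonal_mul_walkProb (ν : Measure ℕ) (n s : ℕ) :
    (n + 1) * ∑ x ∈ Finset.HasAntidiagonal.antidiagonal s, x.1 * (ν.real {x.1} * walkProb ν n x.2) =
      s * walkProb ν (n + 1) s := by
  set G := offspringSeries ν
  have hd : PowerSeries.derivative ℝ (G ^ (n + 1)) =
      ((n + 1 : ℕ) : PowerSeries ℝ) * G ^ n * PowerSeries.derivative ℝ G := by
    rw [Derivation.leibniz_pow]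
    simp [mul_assoc]
  cases s with
  | zero => simp
  | succ s =>
    have h2 : PowerSeries.coeff s (PowerSeries.derivative ℝ (G ^ (n + 1))) =
        walkProb ν (n + 1) (s + 1) * (s + 1) := by
      rw [PowerSeries.coeff_derivative]; rfl
    rw [Nat.cast_add, Nat.cast_one, mul_comm _ (walkProb ν (n + 1) (s + 1)), ← h2, hd,
      mul_assoc, mul_comm (G ^ n), ← map_natCast (PowerSeries.C (R := ℝ)),
      PowerSeries.coeff_C_mul, PowerSeries.coeff_mul, Finset.Nat.antidiagonal_succ]
    simp [PowerSeries.coeff_derivative, G, offspringSeries, walkProb]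
    left
    refine Finset.sum_congr rfl fun x _ => by ring

/-- The Galton–Watson weight of a tree, as a real number. -/
noncomputable def realWeight (ν : Measure ℕ) (t : PlaneTree) : ℝ := (gwWeight ν t).toReal

/-- The weight of a forest: the product of the weights of its trees. -/
noncomputable def forestWeight (ν : Measure ℕ) (L : List PlaneTree) : ℝ :=
  (L.map (realWeight ν)).prod

lemma realWeight_node (ν : Measure ℕ) (ts : List PlaneTree) :
    realWeight ν (node ts) = ν.real {ts.length} * forestWeight ν ts := by
  rw [realWeight, gwWeight, ENNReal.toReal_mul, forestWeight, Measure.real]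
  congr 1
  induction ts with
  | nil => simp
  | cons t ts ih => simp [ih, realWeight]

lemma forestWeight_nil (ν : Measure ℕ) : forestWeight ν [] = 1 := by simp [forestWeight]

lemma forestWeight_cons (ν : Measure ℕ) (t : PlaneTree) (L : List PlaneTree) :
    forestWeight ν (t :: L) = realWeight ν t * forestWeight ν L := by
  simp [forestWeight]

lemma forestWeight_node_take_drop (ν : Measure ℕ) {L : List PlaneTree} {i : ℕ}
    (hi : i ≤ L.length) :
    forestWeight ν (node (L.take i) :: L.drop i) = ν.real {i} * forestWeight ν L := by
  rw [forestWeight_cons, realWeight_node, List.length_take, min_eq_left hi, mul_assoc]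
  congr 1
  conv_rhs => rw [← List.take_append_drop i L]
  simp only [forestWeight, List.map_append, List.prod_append]

/-- The probability that a forest of `r` independent Galton–Watson trees has `n` nodes. -/
noncomputable def forestProb (ν : Measure ℕ) (n r : ℕ) : ℝ :=
  ∑ L ∈ forests n r, forestWeight ν L

lemma sum_forests_removeRoot (ν : Measure ℕ) (n r N : ℕ) (hN : n < N)
    (H : List PlaneTree → ℝ) :
    ∑ L ∈ forests (n + 1) (r + 1), forestWeight ν L * H (removeRoot L) =
      ∑ i ∈ Finset.range N, ν.real {i} * ∑ L ∈ forests n (r + i), forestWeight ν L * H L := by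
  rw [sum_forests_succ n r N hN]
  refine Finset.sum_congr rfl fun i _ => ?_
  rw [Finset.mul_sum]
  refine Finset.sum_congr rfl fun L hL => ?_
  rw [mem_forests] at hL
  rw [forestWeight_node_take_drop ν (by omega), removeRoot, List.take_append_drop]
  ring

lemma forestProb_succ (ν : Measure ℕ) (n r N : ℕ) (hN : n < N) :
    forestProb ν (n + 1) (r + 1) =
      ∑ i ∈ Finset.range N, ν.real {i} * forestProb ν n (r + i) := by
  simpa [forestProb] using sum_forests_removeRoot ν n r N hN (fun _ => 1)

lemma sum_range_eq_sum_antidiagonal {s N : ℕ} (hN : s < N) (u : ℕ → ℝ)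
    (hu : ∀ i, s < i → u i = 0) :
    ∑ i ∈ Finset.range N, u i = ∑ x ∈ Finset.HasAntidiagonal.antidiagonal s, u x.1 := by
  rw [Finset.Nat.sum_antidiagonal_eq_sum_range_succ_mk]
  symm
  refine Finset.sum_subset (fun i hi => ?_) fun i _ hi => hu i ?_
  · simp only [Finset.mem_range] at *; omega
  · simp only [Finset.mem_range] at *; omega

/-- The forest version of the Otter–Dwass formula `P(|forest| = n) = (r / n) P(S_n = n - r)`. Both
sides satisfy the recursion in `n` that comes from deleting the root of the first tree. -/
lemma mul_forestProb (ν : Measure ℕ) (n : ℕ) :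
    ∀ r, r ≤ n → n * forestProb ν n r = r * walkProb ν n (n - r) := by
  induction n with
  | zero => intro r hr; simp [Nat.le_zero.mp hr]
  | succ n ih =>
    rintro (_ | r) hr
    · simp [forestProb, forests_zero_right]
    rw [forestProb_succ ν n r (n + 1) (by omega)]
    rcases Nat.eq_zero_or_pos n with rfl | hn
    · obtain rfl : r = 0 := by omega
      simp [forestProb, forests_zero_zero, forestWeight_nil, walkProb, offspringSeries]
    obtain ⟨s, hs⟩ : ∃ s, r + s = n := ⟨n - r, by omega⟩
    rw [sum_range_eq_sum_antidiagonal (s := s) (by omega)]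
    swap
    · intro i hi
      simp [forestProb, forests_eq_empty (show n < r + i by omega)]
    have hn' : (n : ℝ) ≠ 0 := by positivity
    apply mul_left_cancel₀ hn'
    have h1 : (n : ℝ) * ∑ x ∈ Finset.HasAntidiagonal.antidiagonal s, ν.real {x.1} * forestProb ν n (r + x.1) =
        r * walkProb ν (n + 1) s +
          ∑ x ∈ Finset.HasAntidiagonal.antidiagonal s, x.1 * (ν.real {x.1} * walkProb ν n x.2) := by
      rw [walkProb_succ, Finset.mul_sum, Finset.mul_sum, ← Finset.sum_add_distrib]
      refine Finset.sum_congr rfl fun x hx => ?_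
      rw [Finset.HasAntidiagonal.mem_antidiagonal] at hx
      have := ih (r + x.1) (by omega)
      rw [show n - (r + x.1) = x.2 by omega] at this
      push_cast at this
      linear_combination (ν.real {x.1}) * this
    have h2 := sum_antidiagonal_mul_walkProb ν n s
    rw [show n + 1 - (r + 1) = s by omega]
    have h3 : (r : ℝ) + s = n := by exact_mod_cast hs
    push_cast
    linear_combination (n + 1 : ℝ) * h1 + h2 + walkProb ν (n + 1) s * h3

/-- `r * P(S_m = m + 1 - r)`, which is zero if `m + 1 < r`. For a fixed tree `t`, the product of
`fringeCoeff ν m r` and the weight of `t` is the expected number of fringe trees equal to `t` in a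
forest of `r` Galton–Watson trees, on the event that the forest has `m + |t|` nodes. -/
noncomputable def fringeCoeff (ν : Measure ℕ) (m r : ℕ) : ℝ :=
  if r ≤ m + 1 then r * walkProb ν m (m + 1 - r) else 0

lemma fringeCoeff_zero (ν : Measure ℕ) (r : ℕ) :
    fringeCoeff ν 0 (r + 1) = forestProb ν 0 r := by
  cases r with
  | zero => simp [fringeCoeff, walkProb, forestProb, forests_zero_zero, forestWeight_nil]
  | succ r => simp [fringeCoeff, forestProb, forests_eq_empty]

/-- The recursion of the coefficients when the root of the first tree is deleted: `forestProb` is the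
contribution of the first tree itself. -/
lemma fringeCoeff_succ (ν : Measure ℕ) (m r N : ℕ) (hN : m + 1 < N) :
    fringeCoeff ν (m + 1) (r + 1) =
      forestProb ν (m + 1) r + ∑ i ∈ Finset.range N, ν.real {i} * fringeCoeff ν m (r + i) := by
  by_cases hr : r ≤ m + 1
  · obtain ⟨s, hs⟩ : ∃ s, r + s = m + 1 := ⟨m + 1 - r, by omega⟩
    rw [sum_range_eq_sum_antidiagonal (s := s) (by omega)]
    swap
    · intro i hi
      rw [fringeCoeff, if_neg (by omega), mul_zero]
    have h1 : ∑ x ∈ Finset.HasAntidiagonal.antidiagonal s, ν.real {x.1} * fringeCoeff ν m (r + x.1) =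
        r * walkProb ν (m + 1) s +
          ∑ x ∈ Finset.HasAntidiagonal.antidiagonal s, x.1 * (ν.real {x.1} * walkProb ν m x.2) := by
      rw [walkProb_succ, Finset.mul_sum, ← Finset.sum_add_distrib]
      refine Finset.sum_congr rfl fun x hx => ?_
      rw [Finset.HasAntidiagonal.mem_antidiagonal] at hx
      rw [fringeCoeff, if_pos (by omega), show m + 1 - (r + x.1) = x.2 by omega]
      push_cast
      ring
    have h2 := sum_antidiagonal_mul_walkProb ν m s
    have h3 := mul_forestProb ν (m + 1) r hr
    rw [show m + 1 - r = s by omega] at h3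
    rw [fringeCoeff, if_pos (by omega), show m + 1 + 1 - (r + 1) = s by omega, h1]
    have h4 : (r : ℝ) + s = m + 1 := by exact_mod_cast hs
    have hm : (m : ℝ) + 1 ≠ 0 := by positivity
    apply mul_left_cancel₀ hm
    push_cast at h3 ⊢
    linear_combination -h2 - h3 - walkProb ν (m + 1) s * h4
  · rw [fringeCoeff, if_neg (by omega), forestProb, forests_eq_empty (by omega),
      Finset.sum_empty, zero_add]
    symm
    refine Finset.sum_eq_zero fun i _ => ?_
    rw [fringeCoeff, if_neg (by omega), mul_zero]

/-- The unnormalised expectation of `f` on the event that the tree has `n` nodes. -/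
noncomputable def treeMean (ν : Measure ℕ) (f : PlaneTree → ℝ) (n : ℕ) : ℝ :=
  ∑ t ∈ trees n, realWeight ν t * f t

lemma trees_zero : trees 0 = ∅ := by
  ext t
  have := size_pos t
  simp only [mem_trees, Finset.notMem_empty, iff_false]
  omega

lemma treeMean_zero (ν : Measure ℕ) (f : PlaneTree → ℝ) : treeMean ν f 0 = 0 := by
  simp [treeMean, trees_zero]

/-- The expectation of an additive functional of a forest, by splitting off the contribution of
the root of the first tree. -/
lemma sum_forests_additive (ν : Measure ℕ) (f : PlaneTree → ℝ) (n : ℕ) :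
    ∀ r, ∑ L ∈ forests n r, forestWeight ν L * (L.map (additive f)).sum =
      ∑ x ∈ Finset.HasAntidiagonal.antidiagonal n, treeMean ν f x.1 * fringeCoeff ν x.2 r := by
  induction n with
  | zero =>
    intro r
    simp only [Finset.Nat.antidiagonal_zero, Finset.sum_singleton, treeMean_zero, zero_mul]
    refine Finset.sum_eq_zero fun L hL => ?_
    rw [mem_forests] at hL
    have := length_le_sum_size L
    rw [List.length_eq_zero_iff.mp (show L.length = 0 by omega)]
    simp
  | succ n ih =>
    rintro (_ | r)
    · rw [forests_zero_right (by omega), Finset.sum_empty]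
      symm
      exact Finset.sum_eq_zero fun x _ => by simp [fringeCoeff]
    have hsplit : ∀ L ∈ forests (n + 1) (r + 1),
        forestWeight ν L * (L.map (additive f)).sum =
          forestWeight ν L * (L.head?.map f).getD 0 +
            forestWeight ν L * ((removeRoot L).map (additive f)).sum := by
      rintro (_ | ⟨⟨ts⟩, R⟩) hL
      · simp [mem_forests] at hL
      · simp only [List.map_cons, List.sum_cons, additive_node, removeRoot, List.map_append,
          List.sum_append, List.head?_cons, Option.map_some, Option.getD_some]
        ring
    rw [Finset.sum_congr rfl hsplit, Finset.sum_add_distrib,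
      sum_forests_removeRoot ν n r (n + 2) (by omega) fun L => (L.map (additive f)).sum,
      sum_forests_cons]
    simp_rw [ih]
    have hhead : ∀ x ∈ Finset.HasAntidiagonal.antidiagonal (n + 1),
        ∑ t ∈ trees x.1, ∑ R ∈ forests x.2 r,
          forestWeight ν (t :: R) * ((t :: R).head?.map f).getD 0 =
        treeMean ν f x.1 * forestProb ν x.2 r := by
      intro x _
      rw [treeMean, forestProb, Finset.sum_mul_sum]
      refine Finset.sum_congr rfl fun t _ => Finset.sum_congr rfl fun R _ => ?_
      rw [forestWeight_cons]
      simp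
      ring
    have hrest : ∑ i ∈ Finset.range (n + 2), ν.real {i} *
          ∑ x ∈ Finset.HasAntidiagonal.antidiagonal n, treeMean ν f x.1 * fringeCoeff ν x.2 (r + i) =
        ∑ x ∈ Finset.HasAntidiagonal.antidiagonal n, treeMean ν f x.1 *
          ∑ i ∈ Finset.range (n + 2), ν.real {i} * fringeCoeff ν x.2 (r + i) := by
      simp_rw [Finset.mul_sum]
      rw [Finset.sum_comm]
      refine Finset.sum_congr rfl fun x _ => Finset.sum_congr rfl fun i _ => by ring
    rw [Finset.sum_congr rfl hhead, hrest, Finset.Nat.antidiagonal_succ',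
      Finset.sum_cons, Finset.sum_map, Finset.sum_cons, Finset.sum_map, fringeCoeff_zero, add_assoc,
      ← Finset.sum_add_distrib]
    congr 1
    refine Finset.sum_congr rfl fun x hx => ?_
    rw [Finset.HasAntidiagonal.mem_antidiagonal] at hx
    simp only [Function.Embedding.prodMap, Function.Embedding.coeFn_mk, Prod.map,
      Function.Embedding.refl_apply, Nat.succ_eq_add_one]
    rw [fringeCoeff_succ ν x.2 r (n + 2) (by omega)]
    ring

lemma sum_forests_one (n : ℕ) (H : List PlaneTree → ℝ) :
    ∑ L ∈ forests n 1, H L = ∑ t ∈ trees n, H [t] := by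
  symm
  refine Finset.sum_bij (fun t _ => [t]) ?_ ?_ ?_ ?_
  · intro t ht
    simpa [mem_forests, mem_trees] using ht
  · intro a _ b _ h
    simpa using h
  · intro L hL
    rw [mem_forests] at hL
    obtain ⟨t, rfl⟩ := List.length_eq_one_iff.mp hL.2
    exact ⟨t, by simpa [mem_trees] using hL.1, rfl⟩
  · intros; rfl

/-- The expectation of the additive functional on the event `|𝒯| = n` is a convolution. -/
lemma treeMean_additive (ν : Measure ℕ) (f : PlaneTree → ℝ) (n : ℕ) :
    treeMean ν (additive f) n =
      ∑ x ∈ Finset.HasAntidiagonal.antidiagonal n, treeMean ν f x.1 * walkProb ν x.2 x.2 := by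
  have := sum_forests_additive ν f n 1
  rw [sum_forests_one] at this
  simpa [forestWeight, treeMean, fringeCoeff] using this

/-- The Otter–Dwass formula `n P(|𝒯| = n) = P(S_n = n - 1)`. -/
lemma mul_treeMean_one (ν : Measure ℕ) {n : ℕ} (hn : 1 ≤ n) :
    n * treeMean ν (fun _ => 1) n = walkProb ν n (n - 1) := by
  have := mul_forestProb ν n 1 hn
  rw [forestProb, sum_forests_one] at this
  simpa [forestWeight, treeMean] using this

/-! ### Expectations of conditioned Galton–Watson trees as finite sums -/

instance : MeasurableSingletonClass PlaneTree := ⟨fun _ => trivial⟩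

lemma measurableSet_planeTree (s : Set PlaneTree) : MeasurableSet s := trivial

lemma gwLaw_singleton (ν : Measure ℕ) (t : PlaneTree) : gwLaw ν {t} = gwWeight ν t := by
  rw [gwLaw, Measure.sum_apply _ (measurableSet_planeTree _), tsum_eq_single t]
  · simp
  · intro t' ht'
    simp [ht']

/-- Induction on the size `n`, since `PlaneTree` is a nested inductive type. -/
lemma gwWeight_ne_top (ν : Measure ℕ) [IsFiniteMeasure ν] (n : ℕ) :
    ∀ t : PlaneTree, t.size = n → gwWeight ν t ≠ ⊤ := by
  induction n using Nat.strong_induction_on with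
  | _ n ih =>
    rintro ⟨ts⟩ ht
    rw [size_node] at ht
    rw [gwWeight]
    refine ENNReal.mul_ne_top (measure_ne_top _ _) ?_
    have hlt : (ts.map size).sum < n := by omega
    clear ht
    induction ts with
    | nil => simp
    | cons t ts ih' =>
      rw [List.map_cons, List.sum_cons] at hlt
      rw [List.map_cons, List.prod_cons]
      exact ENNReal.mul_ne_top (ih t.size (by omega) t rfl) (ih' (by omega))

lemma coe_trees (n : ℕ) : (trees n : Set PlaneTree) = {t | t.size = n} := by
  ext t
  simp [mem_trees]

variable (ν : Measure ℕ) [IsFiniteMeasure ν] (f : PlaneTree → ℝ) (n : ℕ)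

lemma gwLaw_size_eq_lt_top : gwLaw ν {t | t.size = n} < ⊤ := by
  rw [← coe_trees, ← sum_measure_singleton]
  exact ENNReal.sum_lt_top.mpr fun t _ => by
    rw [gwLaw_singleton]; exact (gwWeight_ne_top ν _ t rfl).lt_top

lemma setIntegral_size_eq : ∫ t in {t | t.size = n}, f t ∂(gwLaw ν) = treeMean ν f n := by
  have hfin : IsFiniteMeasure ((gwLaw ν).restrict (trees n : Set PlaneTree)) :=
    ⟨by rw [Measure.restrict_apply_univ, coe_trees]; exact gwLaw_size_eq_lt_top ν n⟩
  have hint : IntegrableOn f (trees n : Set PlaneTree) (gwLaw ν) := by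
    have := IntegrableOn.finset (μ := (gwLaw ν).restrict (trees n : Set PlaneTree))
      (s := trees n) (f := f)
    rwa [IntegrableOn, Measure.restrict_restrict (measurableSet_planeTree _), Set.inter_self]
      at this
  rw [← coe_trees, setIntegral_finset _ hint]
  refine Finset.sum_congr rfl fun t _ => ?_
  rw [Measure.real, gwLaw_singleton, smul_eq_mul, realWeight]

lemma treeMean_one : treeMean ν (fun _ => 1) n = (gwLaw ν {t | t.size = n}).toReal := by
  rw [← setIntegral_size_eq]
  simp [Measure.real]

lemma integral_condGW :
    ∫ t, f t ∂(condGW ν n) = treeMean ν f n / treeMean ν (fun _ => 1) n := by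
  rw [condGW, ProbabilityTheory.cond, integral_smul_measure, setIntegral_size_eq, treeMean_one,
    smul_eq_mul, ENNReal.toReal_inv, div_eq_inv_mul]

/-- Summing over the sizes recovers the expectation under the unconditioned law; that the total
mass of `gwLaw ν` is one plays no role. -/
lemma hasSum_treeMean (hf : Integrable f (gwLaw ν)) :
    HasSum (treeMean ν f) (∫ t, f t ∂(gwLaw ν)) := by
  have h := hasSum_integral_iUnion (μ := gwLaw ν) (f := f) (s := fun n => {t | t.size = n})
    (fun n => measurableSet_planeTree _)
    (fun i j hij => Set.disjoint_left.mpr fun t hi hj => hij (by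
      rw [Set.mem_ofPred_eq] at hi hj; omega)) hf.integrableOn
  have hU : (⋃ n, {t : PlaneTree | t.size = n}) = Set.univ := by
    ext t; simp
  rw [hU, setIntegral_univ] at h
  simpa only [setIntegral_size_eq] using h

variable {n}

lemma treeMean_one_pos (hn : n ∈ admissible ν) : 0 < treeMean ν (fun _ => 1) n := by
  rw [treeMean_one]
  exact ENNReal.toReal_pos hn.ne' (gwLaw_size_eq_lt_top ν n).ne

lemma treeMean_eq_zero (hn : n ∉ admissible ν) : treeMean ν f n = 0 := by
  rw [← setIntegral_size_eq]
  refine setIntegral_measure_zero _ ?_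
  by_contra h
  exact hn (pos_iff_ne_zero.mpr h)

lemma one_le_of_mem_admissible (hn : n ∈ admissible ν) : 1 ≤ n := by
  rcases Nat.eq_zero_or_pos n with rfl | h
  · exact absurd (treeMean_one_pos ν hn) (by rw [treeMean_zero]; simp)
  · exact h

lemma treeMean_eq_mul (hn : n ∈ admissible ν) :
    treeMean ν f n = treeMean ν (fun _ => 1) n * ∫ t, f t ∂(condGW ν n) := by
  rw [integral_condGW, mul_div_cancel₀]
  exact (treeMean_one_pos ν hn).ne'

end PlaneTree

/-! ### Fourier integrals of powers of a function that is Gaussian near the origin -/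

namespace LocalLimit

open Real

lemma continuous_abs_rpow_mul_exp {q : ℝ} (hq : 0 ≤ q) (b : ℝ) :
    Continuous fun t : ℝ => |t| ^ q * exp (-b * t ^ 2) := by
  have : Continuous fun t : ℝ => |t| ^ q := continuous_abs.rpow_const fun _ => Or.inr hq
  fun_prop

/-- Truncated absolute moments of the Gaussian weight `exp (-b n t²)` have the order of magnitude
given by scaling. -/
lemma exists_integral_abs_rpow_mul_exp_le {q b : ℝ} (hq : 0 ≤ q) (hb : 0 < b) {a : ℝ}
    (ha : 0 < a) :
    ∃ K : ℝ, 0 ≤ K ∧ ∀ n : ℕ, 1 ≤ n →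
      ∫ t in (-a)..a, |t| ^ q * exp (-(b * n) * t ^ 2) ≤ K * (n : ℝ) ^ (-(q + 1) / 2) := by
  have hG : 0 < Gamma ((q + 1) / 2) := Gamma_pos_of_pos (by positivity)
  refine ⟨b ^ (-(q + 1) / 2) * Gamma ((q + 1) / 2), by positivity, fun n hn => ?_⟩
  have hn' : (0 : ℝ) < n := by exact_mod_cast hn
  have hbn : 0 < b * n := by positivity
  have hval : ∫ t : ℝ, |t| ^ q * exp (-(b * n) * |t| ^ 2) =
      2 * ((b * n) ^ (-(q + 1) / 2) * (1 / 2) * Gamma ((q + 1) / 2)) := by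
    rw [integral_comp_abs (f := fun t => t ^ q * exp (-(b * n) * t ^ 2))]
    simp_rw [← rpow_two]
    rw [integral_rpow_mul_exp_neg_mul_rpow two_pos (by linarith) hbn]
  -- The integral of a non-integrable function is zero by convention, so a nonzero value suffices.
  have hint : Integrable fun t : ℝ => |t| ^ q * exp (-(b * n) * |t| ^ 2) :=
    .of_integral_ne_zero (by rw [hval]; positivity)
  calc ∫ t in (-a)..a, |t| ^ q * exp (-(b * n) * t ^ 2)
      = ∫ t in Set.Ioc (-a) a, |t| ^ q * exp (-(b * n) * |t| ^ 2) := by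
        rw [intervalIntegral.integral_of_le (by linarith)]
        simp_rw [sq_abs]
    _ ≤ ∫ t, |t| ^ q * exp (-(b * n) * |t| ^ 2) :=
        setIntegral_le_integral hint (Eventually.of_forall fun t => by positivity)
    _ = b ^ (-(q + 1) / 2) * Gamma ((q + 1) / 2) * (n : ℝ) ^ (-(q + 1) / 2) := by
        rw [hval, mul_rpow hb.le hn'.le]
        ring

lemma norm_pow_sub_pow_le {x y : ℂ} {M : ℝ} (hx : ‖x‖ ≤ M) (hy : ‖y‖ ≤ M) (n : ℕ) :
    ‖x ^ n - y ^ n‖ ≤ n * M ^ (n - 1) * ‖x - y‖ := by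
  have hM : 0 ≤ M := (norm_nonneg x).trans hx
  rw [← geom_sum₂_mul, norm_mul]
  gcongr
  refine (norm_sum_le _ _).trans ?_
  refine (Finset.sum_le_card_nsmul _ _ (M ^ (n - 1)) fun i hi => ?_).trans (by simp)
  rw [Finset.mem_range] at hi
  rw [norm_mul, norm_pow, norm_pow]
  calc ‖x‖ ^ i * ‖y‖ ^ (n - 1 - i) ≤ M ^ i * M ^ (n - 1 - i) := by gcongr
    _ = M ^ (n - 1) := by rw [← pow_add]; congr 1; omega

variable {ψ : ℝ → ℂ} {a c v C δ : ℝ}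

lemma norm_pow_sub_exp_le (hc : 0 < c) (hcv : c ≤ v)
    (hE : ∀ t, |t| ≤ a → ‖ψ t‖ ≤ exp (-c * t ^ 2))
    (hD : ∀ t, |t| ≤ a → ‖ψ t - (exp (-v * t ^ 2) : ℝ)‖ ≤ C * |t| ^ (2 + δ))
    {n : ℕ} (hn : 1 ≤ n) {t : ℝ} (ht : |t| ≤ a) :
    ‖ψ t ^ n - (exp (-(v * n) * t ^ 2) : ℝ)‖ ≤
      C * exp (c * a ^ 2) * (n * (|t| ^ (2 + δ) * exp (-(c * n) * t ^ 2))) := by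
  have hta : t ^ 2 ≤ a ^ 2 := by rw [← sq_abs]; gcongr
  have h1 : ((exp (-(v * n) * t ^ 2) : ℝ) : ℂ) = ((exp (-v * t ^ 2) : ℝ) : ℂ) ^ n := by
    rw [← Complex.ofReal_pow, ← exp_nat_mul]
    congr 2; ring
  have h2 : ‖((exp (-v * t ^ 2) : ℝ) : ℂ)‖ ≤ exp (-c * t ^ 2) := by
    rw [Complex.norm_real, norm_of_nonneg (exp_pos _).le]
    gcongr
  have h3 : exp (-c * t ^ 2) ^ (n - 1) ≤ exp (c * a ^ 2) * exp (-(c * n) * t ^ 2) := by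
    rw [← exp_nat_mul, ← exp_add, Nat.cast_sub hn]
    gcongr
    push_cast
    nlinarith
  rw [h1]
  calc _ ≤ n * exp (-c * t ^ 2) ^ (n - 1) * ‖ψ t - (exp (-v * t ^ 2) : ℝ)‖ :=
        norm_pow_sub_pow_le (hE t ht) h2 n
    _ ≤ n * (exp (c * a ^ 2) * exp (-(c * n) * t ^ 2)) * (C * |t| ^ (2 + δ)) := by
        gcongr; exact hD t ht
    _ = _ := by ring

lemma norm_pow_le (hE : ∀ t, |t| ≤ a → ‖ψ t‖ ≤ exp (-c * t ^ 2)) (n : ℕ) {t : ℝ}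
    (ht : |t| ≤ a) : ‖ψ t ^ n‖ ≤ exp (-(c * n) * t ^ 2) := by
  rw [norm_pow]
  refine (pow_le_pow_left₀ (norm_nonneg _) (hE t ht) n).trans_eq ?_
  rw [← exp_nat_mul]
  congr 1; ring

lemma abs_le_of_mem_Icc {t : ℝ} (ht : t ∈ Set.Icc (-a) a) : |t| ≤ a := abs_le.mpr ht

/-- The real part of the Fourier integral of `ψ ^ n` at the frequency `j`, over `[-a, a]`. -/
noncomputable def fourier (ψ : ℝ → ℂ) (a : ℝ) (n : ℕ) (j : ℝ) : ℝ :=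
  ∫ t in (-a)..a, (ψ t ^ n * Complex.exp (j * t * Complex.I)).re

lemma continuous_integrand (hψ : Continuous ψ) (n : ℕ) (j : ℝ) :
    Continuous fun t : ℝ => (ψ t ^ n * Complex.exp (j * t * Complex.I)).re := by
  fun_prop

lemma norm_exp_mul_mul_I (j t : ℝ) : ‖Complex.exp (j * t * Complex.I)‖ = 1 := by
  rw [← Complex.ofReal_mul, Complex.norm_exp_ofReal_mul_I]

lemma exists_abs_fourier_le (ha : 0 < a) (hc : 0 < c)
    (hE : ∀ t, |t| ≤ a → ‖ψ t‖ ≤ exp (-c * t ^ 2)) :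
    ∃ K : ℝ, 0 ≤ K ∧ ∀ (n : ℕ) (j : ℝ), 1 ≤ n →
      |fourier ψ a n j| ≤ K * (n : ℝ) ^ (-(1 / 2) : ℝ) := by
  obtain ⟨K, hK, h⟩ := exists_integral_abs_rpow_mul_exp_le (le_refl (0 : ℝ)) hc ha
  refine ⟨K, hK, fun n j hn => ?_⟩
  rw [fourier, ← norm_eq_abs]
  refine (intervalIntegral.norm_integral_le_of_norm_le (by linarith)
    (g := fun t => |t| ^ (0 : ℝ) * exp (-(c * n) * t ^ 2)) ?_ ?_).trans ((h n hn).trans_eq ?_)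
  · refine Eventually.of_forall fun t ht => ?_
    have ht' := abs_le_of_mem_Icc ⟨ht.1.le, ht.2⟩
    rw [rpow_zero, one_mul]
    refine (Complex.abs_re_le_norm _).trans ?_
    rw [norm_mul, norm_exp_mul_mul_I, mul_one]
    exact norm_pow_le hE n ht'
  · exact (continuous_abs_rpow_mul_exp le_rfl _).intervalIntegrable _ _
  · norm_num

lemma rpow_abs_two (t : ℝ) : |t| ^ (2 : ℝ) = t ^ 2 := by
  rw [rpow_two, sq_abs]

/-- The integrand is bounded below on the interval of half-width `a / √n`. -/
lemma integral_exp_neg_mul_sq_ge (ha : 0 < a) (hv : 0 < v) {n : ℕ} (hn : 1 ≤ n) :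
    2 * a * exp (-v * a ^ 2) * (n : ℝ) ^ (-(1 / 2) : ℝ) ≤
      ∫ t in (-a)..a, exp (-(v * n) * t ^ 2) := by
  have hn' : (1 : ℝ) ≤ n := by exact_mod_cast hn
  set d : ℝ := a * (n : ℝ) ^ (-(1 / 2) : ℝ) with hd
  have hd0 : 0 < d := by positivity
  have hda : d ≤ a := by
    have : (n : ℝ) ^ (-(1 / 2) : ℝ) ≤ 1 := rpow_le_one_of_one_le_of_nonpos hn' (by norm_num)
    nlinarith
  have hdn : n * d ^ 2 = a ^ 2 := by
    rw [hd, mul_pow, ← rpow_natCast ((n : ℝ) ^ _), ← rpow_mul (by positivity)]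
    norm_num [rpow_neg_one]
    field_simp
  have hcont : Continuous fun t : ℝ => exp (-(v * n) * t ^ 2) := by fun_prop
  calc 2 * a * exp (-v * a ^ 2) * (n : ℝ) ^ (-(1 / 2) : ℝ)
      = ∫ t in (-d)..d, exp (-v * a ^ 2) := by
        rw [intervalIntegral.integral_const, smul_eq_mul, hd]; ring
    _ ≤ ∫ t in (-d)..d, exp (-(v * n) * t ^ 2) := by
        refine intervalIntegral.integral_mono_on (by linarith) (by simp)
          (hcont.intervalIntegrable _ _) fun t ht => ?_
        have : t ^ 2 ≤ d ^ 2 := by rw [← sq_abs]; gcongr; exact abs_le.mpr ht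
        rw [exp_le_exp, ← hdn]
        have : v * n * t ^ 2 ≤ v * n * d ^ 2 := by gcongr
        linarith
    _ ≤ ∫ t in (-a)..a, exp (-(v * n) * t ^ 2) := by
        refine intervalIntegral.integral_mono_interval (by linarith) (by linarith) hda
          (Eventually.of_forall fun t => (exp_pos _).le) (hcont.intervalIntegrable _ _)

/-- Lower bound in the local limit theorem: the Fourier integral differs from its Gaussian
counterpart by `O(n ^ (-1/2 - δ/2) + n ^ (-3/2))`. -/
lemma exists_le_fourier_one (hψ : Continuous ψ) (ha : 0 < a) (hc : 0 < c) (hcv : c ≤ v)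
    (hC : 0 ≤ C) (hδ : 0 < δ)
    (hE : ∀ t, |t| ≤ a → ‖ψ t‖ ≤ exp (-c * t ^ 2))
    (hD : ∀ t, |t| ≤ a → ‖ψ t - (exp (-v * t ^ 2) : ℝ)‖ ≤ C * |t| ^ (2 + δ)) :
    ∃ κ : ℝ, 0 < κ ∧ ∀ᶠ n : ℕ in atTop,
      κ * (n : ℝ) ^ (-(1 / 2) : ℝ) ≤ fourier ψ a n 1 := by
  have hv : 0 < v := hc.trans_le hcv
  obtain ⟨K₁, hK₁, h₁⟩ :=
    exists_integral_abs_rpow_mul_exp_le (show 0 ≤ 2 + δ by positivity) hc ha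
  obtain ⟨K₂, hK₂, h₂⟩ := exists_integral_abs_rpow_mul_exp_le (zero_le_two (α := ℝ)) hv ha
  set C' := C * exp (c * a ^ 2) with hC'
  have hC'0 : 0 ≤ C' := by positivity
  set κ := 2 * a * exp (-v * a ^ 2)
  have hκ : 0 < κ := by positivity
  refine ⟨κ / 2, by positivity, ?_⟩
  have hlim : Tendsto (fun n : ℕ => C' * K₁ * (n : ℝ) ^ (-(δ / 2)) + K₂ * (n : ℝ) ^ (-1 : ℝ))
      atTop (𝓝 (C' * K₁ * 0 + K₂ * 0)) := by
    refine (Tendsto.const_mul _ ?_).add (Tendsto.const_mul _ ?_)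
    · exact (tendsto_rpow_neg_atTop (by positivity)).comp tendsto_natCast_atTop_atTop
    · exact (tendsto_rpow_neg_atTop one_pos).comp tendsto_natCast_atTop_atTop
  have hev := hlim.eventually_lt_const (u := κ / 2) (by simpa using by positivity)
  filter_upwards [hev, eventually_ge_atTop 1] with n hn hn1
  have hn0 : (0 : ℝ) < n := by exact_mod_cast hn1
  have hcont := continuous_integrand hψ n 1
  have hi₁ := ((continuous_abs_rpow_mul_exp (show 0 ≤ 2 + δ by positivity)
    (c * n)).intervalIntegrable (μ := volume) (-a) a).const_mul (C' * n)
  have hi₂ := (continuous_abs_rpow_mul_exp (zero_le_two (α := ℝ))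
    (v * n)).intervalIntegrable (μ := volume) (-a) a
  have hi₀ : IntervalIntegrable (fun t : ℝ => exp (-(v * n) * t ^ 2)) volume (-a) a :=
    (by fun_prop : Continuous fun t : ℝ => exp (-(v * n) * t ^ 2)).intervalIntegrable _ _
  have hmono : ∫ t in (-a)..a, (exp (-(v * n) * t ^ 2)
      - C' * n * (|t| ^ (2 + δ) * exp (-(c * n) * t ^ 2))
      - |t| ^ (2 : ℝ) * exp (-(v * n) * t ^ 2)) ≤ fourier ψ a n 1 := by
    refine intervalIntegral.integral_mono_on (by linarith) ((hi₀.sub hi₁).sub hi₂)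
      (hcont.intervalIntegrable _ _) fun t ht => ?_
    have ht' := abs_le_of_mem_Icc ht
    have e1 := norm_pow_sub_exp_le hc hcv hE hD hn1 ht'
    set γ := exp (-(v * n) * t ^ 2)
    have hγ : 0 < γ := exp_pos _
    set z := Complex.exp ((1 : ℝ) * t * Complex.I) with hz
    have e2 : ψ t ^ n * z = (ψ t ^ n - (γ : ℂ)) * z + (γ : ℂ) * z := by ring
    have e3 : |((ψ t ^ n - (γ : ℂ)) * z).re| ≤ ‖ψ t ^ n - (γ : ℂ)‖ := by
      refine (Complex.abs_re_le_norm _).trans_eq ?_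
      rw [norm_mul, hz, norm_exp_mul_mul_I, mul_one]
    have e4 : ((γ : ℂ) * z).re = γ * cos t := by
      rw [Complex.re_ofReal_mul, hz, Complex.ofReal_one, one_mul, Complex.exp_ofReal_mul_I_re]
    have e5 : 1 - t ^ 2 / 2 ≤ cos t := one_sub_sq_div_two_le_cos
    rw [e2, Complex.add_re, e4, rpow_abs_two]
    have e6 := neg_le_of_abs_le e3
    have e7 : γ * (1 - t ^ 2) ≤ γ * cos t := by
      gcongr
      nlinarith [sq_nonneg t]
    rw [← hC'] at e1
    nlinarith
  rw [intervalIntegral.integral_sub (hi₀.sub hi₁) hi₂, intervalIntegral.integral_sub hi₀ hi₁,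
    intervalIntegral.integral_const_mul] at hmono
  have g0 := integral_exp_neg_mul_sq_ge ha hv hn1
  have g1 := mul_le_mul_of_nonneg_left (h₁ n hn1) (show 0 ≤ C' * n by positivity)
  have g2 := h₂ n hn1
  have r1 : (n : ℝ) * (n : ℝ) ^ (-(2 + δ + 1) / 2) =
      (n : ℝ) ^ (-(δ / 2)) * (n : ℝ) ^ (-(1 / 2) : ℝ) := by
    rw [← rpow_one_add' hn0.le (by linarith), ← rpow_add hn0]
    congr 1; ring
  have r2 : (n : ℝ) ^ (-(2 + 1) / 2 : ℝ) = (n : ℝ) ^ (-1 : ℝ) * (n : ℝ) ^ (-(1 / 2) : ℝ) := by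
    rw [← rpow_add hn0]
    norm_num
  have hs : 0 < (n : ℝ) ^ (-(1 / 2) : ℝ) := by positivity
  have key := mul_lt_mul_of_pos_right hn hs
  have r1' : C' * n * (K₁ * (n : ℝ) ^ (-(2 + δ + 1) / 2)) =
      C' * K₁ * (n : ℝ) ^ (-(δ / 2)) * (n : ℝ) ^ (-(1 / 2) : ℝ) := by
    linear_combination C' * K₁ * r1
  rw [r1'] at g1
  rw [r2] at g2
  linarith

/-- The difference of two Fourier integrals with nearby parameters. The first-order term of
`1 - exp (it)` is odd, so it contributes only through the deviation of `ψ ^ n` from the Gaussian. -/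
lemma exists_abs_fourier_sub_le (hψ : Continuous ψ) (ha : 0 < a) (hc : 0 < c) (hcv : c ≤ v)
    (hC : 0 ≤ C) (hδ : 0 < δ)
    (hE : ∀ t, |t| ≤ a → ‖ψ t‖ ≤ exp (-c * t ^ 2))
    (hD : ∀ t, |t| ≤ a → ‖ψ t - (exp (-v * t ^ 2) : ℝ)‖ ≤ C * |t| ^ (2 + δ)) :
    ∃ K : ℝ, 0 ≤ K ∧ ∀ n k : ℕ, 1 ≤ k → 2 * k ≤ n →
      |fourier ψ a (n - k) 0 - fourier ψ a n 1| ≤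
        K * (k * (n : ℝ) ^ (-(3 / 2) : ℝ) + (n : ℝ) ^ (-1 - δ / 2)) := by
  have hv : 0 < v := hc.trans_le hcv
  obtain ⟨K₁, hK₁, h₁⟩ :=
    exists_integral_abs_rpow_mul_exp_le (show 0 ≤ 3 + δ by positivity) hc ha
  obtain ⟨K₂, hK₂, h₂⟩ :=
    exists_integral_abs_rpow_mul_exp_le (zero_le_two (α := ℝ)) (half_pos hc) ha
  set C' := C * exp (c * a ^ 2) with hC'
  have hC'0 : 0 ≤ C' := by positivity
  set B := C * a ^ δ + v with hB
  have hB0 : 0 ≤ B := by positivity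
  have hone : ∀ t, |t| ≤ a → ‖1 - ψ t‖ ≤ B * t ^ 2 := by
    intro t ht
    have e1 : ‖(1 : ℂ) - (exp (-v * t ^ 2) : ℝ)‖ ≤ v * t ^ 2 := by
      rw [← Complex.ofReal_one, ← Complex.ofReal_sub, Complex.norm_real, norm_of_nonneg]
      · have := add_one_le_exp (-v * t ^ 2); linarith
      · have : exp (-v * t ^ 2) ≤ 1 := exp_le_one_iff.mpr (by nlinarith [sq_nonneg t])
        linarith
    have e2 : |t| ^ (2 + δ) ≤ a ^ δ * t ^ 2 := by
      rw [rpow_add' (abs_nonneg _) (by positivity), rpow_abs_two, mul_comm]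
      gcongr
    calc ‖1 - ψ t‖ = ‖(1 - ((exp (-v * t ^ 2) : ℝ) : ℂ)) - (ψ t - (exp (-v * t ^ 2) : ℝ))‖ := by
          congr 1; ring
      _ ≤ v * t ^ 2 + C * |t| ^ (2 + δ) := (norm_sub_le _ _).trans (add_le_add e1 (hD t ht))
      _ ≤ v * t ^ 2 + C * (a ^ δ * t ^ 2) := by gcongr
      _ = B * t ^ 2 := by rw [hB]; ring
  refine ⟨max ((B + 1) * K₂) (C' * K₁), by positivity, fun n k hk hkn => ?_⟩
  have hn1 : 1 ≤ n := by omega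
  have hn0 : (0 : ℝ) < n := by exact_mod_cast hn1
  have hk1 : (1 : ℝ) ≤ k := by exact_mod_cast hk
  have hkn' : 2 * (k : ℝ) ≤ n := by exact_mod_cast hkn
  have hi₁ := ((continuous_abs_rpow_mul_exp (show 0 ≤ 3 + δ by positivity)
    (c * n)).intervalIntegrable (μ := volume) (-a) a).const_mul (C' * n)
  have hi₂ := ((continuous_abs_rpow_mul_exp (zero_le_two (α := ℝ))
    (c / 2 * n)).intervalIntegrable (μ := volume) (-a) a).const_mul ((B + 1) * k)
  have hbound : |fourier ψ a (n - k) 0 - fourier ψ a n 1| ≤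
      ∫ t in (-a)..a, ((B + 1) * k * (|t| ^ (2 : ℝ) * exp (-(c / 2 * n) * t ^ 2))
        + C' * n * (|t| ^ (3 + δ) * exp (-(c * n) * t ^ 2))) := by
    rw [fourier, fourier, ← intervalIntegral.integral_sub
      ((continuous_integrand hψ _ _).intervalIntegrable _ _)
      ((continuous_integrand hψ _ _).intervalIntegrable _ _), ← norm_eq_abs]
    refine intervalIntegral.norm_integral_le_of_norm_le (by linarith)
      (Eventually.of_forall fun t ht => ?_) (hi₂.add hi₁)
    have ht' := abs_le_of_mem_Icc ⟨ht.1.le, ht.2⟩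
    have e1 := norm_pow_sub_exp_le hc hcv hE hD hn1 ht'
    have hexp : exp (-(c * (n - k : ℕ)) * t ^ 2) ≤ exp (-(c / 2 * n) * t ^ 2) := by
      rw [Nat.cast_sub (by omega)]
      rw [exp_le_exp]
      have : c / 2 * n ≤ c * (n - k) := by nlinarith
      nlinarith [sq_nonneg t]
    have hexp' : exp (-(v * n) * t ^ 2) ≤ exp (-(c / 2 * n) * t ^ 2) := by
      gcongr
      linarith
    set γ := exp (-(v * n) * t ^ 2)
    have hγ : 0 < γ := exp_pos _
    rw [Complex.ofReal_zero, zero_mul, zero_mul, Complex.exp_zero, mul_one]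
    set z := Complex.exp ((1 : ℝ) * t * Complex.I) with hz
    have hzre : z.re = cos t := by
      rw [hz, Complex.ofReal_one, one_mul, Complex.exp_ofReal_mul_I_re]
    have hz1 : ‖1 - z‖ ≤ |t| := by
      rw [norm_sub_rev, hz, Complex.ofReal_one, one_mul, mul_comm]
      exact norm_exp_I_mul_ofReal_sub_one_le
    -- The first term accounts for the `k` missing factors, the second for the deviation of `ψ ^ n`
    -- from the Gaussian `γ`; the real part of the third is `γ * (1 - cos t)`.
    have hsplit : ψ t ^ (n - k) - ψ t ^ n * z =
        ψ t ^ (n - k) * (1 - ψ t ^ k) + (ψ t ^ n - (γ : ℂ)) * (1 - z) + (γ : ℂ) * (1 - z) := by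
      have : ψ t ^ n = ψ t ^ (n - k) * ψ t ^ k := by rw [← pow_add]; congr 1; omega
      rw [this]; ring
    have b1 : |(ψ t ^ (n - k) * (1 - ψ t ^ k)).re| ≤
        exp (-(c / 2 * n) * t ^ 2) * (k * (B * t ^ 2)) := by
      refine (Complex.abs_re_le_norm _).trans ?_
      rw [norm_mul]
      gcongr
      · exact (norm_pow_le hE _ ht').trans hexp
      · have hle1 : ‖ψ t‖ ≤ 1 :=
          (hE t ht').trans (exp_le_one_iff.mpr (by nlinarith [sq_nonneg t]))
        have := norm_pow_sub_pow_le (x := 1) (y := ψ t) (M := 1) (by simp) hle1 k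
        rw [one_pow, one_pow, mul_one] at this
        exact this.trans (by gcongr; exact hone t ht')
    have b2 : |((ψ t ^ n - (γ : ℂ)) * (1 - z)).re| ≤
        C' * n * (|t| ^ (3 + δ) * exp (-(c * n) * t ^ 2)) := by
      refine (Complex.abs_re_le_norm _).trans ?_
      rw [norm_mul]
      refine (mul_le_mul e1 hz1 (norm_nonneg _) ((norm_nonneg _).trans e1)).trans_eq ?_
      rw [show (3 : ℝ) + δ = (2 + δ) + 1 by ring,
        rpow_add_one' (abs_nonneg t) (by positivity), hC']
      ring
    have b3 : |((γ : ℂ) * (1 - z)).re| ≤ exp (-(c / 2 * n) * t ^ 2) * t ^ 2 := by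
      rw [Complex.re_ofReal_mul, Complex.sub_re, Complex.one_re, hzre, abs_mul,
        abs_of_pos hγ]
      have e5 : 1 - t ^ 2 / 2 ≤ cos t := one_sub_sq_div_two_le_cos
      gcongr
      rw [abs_of_nonneg (by linarith [cos_le_one t])]
      nlinarith [sq_nonneg t]
    have hre : (ψ t ^ (n - k)).re - (ψ t ^ n * z).re = (ψ t ^ (n - k) * (1 - ψ t ^ k)).re
        + ((ψ t ^ n - (γ : ℂ)) * (1 - z)).re + ((γ : ℂ) * (1 - z)).re := by
      rw [← Complex.sub_re, hsplit, Complex.add_re, Complex.add_re]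
    rw [norm_eq_abs, hre, rpow_abs_two]
    have hk' : exp (-(c / 2 * n) * t ^ 2) * t ^ 2 ≤ exp (-(c / 2 * n) * t ^ 2) * (k * t ^ 2) := by
      gcongr
      nlinarith [sq_nonneg t]
    refine (abs_add_three _ _ _).trans ((add_le_add_three b1 b2 (b3.trans hk')).trans_eq ?_)
    ring
  rw [intervalIntegral.integral_add hi₂ hi₁, intervalIntegral.integral_const_mul,
    intervalIntegral.integral_const_mul] at hbound
  have g1 := mul_le_mul_of_nonneg_left (h₁ n hn1) (show 0 ≤ C' * n by positivity)
  have g2 := mul_le_mul_of_nonneg_left (h₂ n hn1) (show 0 ≤ (B + 1) * k by positivity)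
  have r1 : (n : ℝ) * (n : ℝ) ^ (-(3 + δ + 1) / 2) = (n : ℝ) ^ (-1 - δ / 2) := by
    rw [← rpow_one_add' hn0.le (by linarith)]
    congr 1; ring
  have r2 : (-(2 + 1) / 2 : ℝ) = -(3 / 2) := by norm_num
  rw [r2] at g2
  calc _ ≤ (B + 1) * k * (K₂ * (n : ℝ) ^ (-(3 / 2) : ℝ)) +
        C' * n * (K₁ * (n : ℝ) ^ (-(3 + δ + 1) / 2)) := hbound.trans (add_le_add g2 g1)
    _ = (B + 1) * K₂ * (k * (n : ℝ) ^ (-(3 / 2) : ℝ)) + C' * K₁ * (n : ℝ) ^ (-1 - δ / 2) := by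
        rw [← r1]; ring
    _ ≤ _ := by
        rw [mul_add]
        gcongr
        · exact le_max_left _ _
        · exact le_max_right _ _

end LocalLimit

namespace LocalLimit

open Real

/-! ### The characteristic function of a centred integer-valued variable -/

/-- The characteristic function of `ξ - 1`, where `ξ` has the law `ν`. -/
noncomputable def centredCharFun (ν : Measure ℕ) (t : ℝ) : ℂ :=
  ∫ k, Complex.exp (((t * (k - 1) : ℝ) : ℂ) * Complex.I) ∂ν

variable (ν : Measure ℕ)

lemma integrable_exp [IsFiniteMeasure ν] (g : ℕ → ℝ) :
    Integrable (fun k => Complex.exp ((g k : ℂ) * Complex.I)) ν :=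
  (integrable_const (1 : ℝ)).mono' (Measurable.of_discrete).aestronglyMeasurable
    (Eventually.of_forall fun k => by rw [Complex.norm_exp_ofReal_mul_I])

lemma continuous_centredCharFun [IsFiniteMeasure ν] : Continuous (centredCharFun ν) := by
  refine continuous_of_dominated (bound := fun _ => 1)
    (fun t => (integrable_exp ν _).aestronglyMeasurable)
    (fun t => Eventually.of_forall fun k => ?_) (integrable_const _)
    (Eventually.of_forall fun k => by fun_prop)
  rw [Complex.norm_exp_ofReal_mul_I]

lemma measureReal_mul_le_integral [IsFiniteMeasure ν] {g : ℕ → ℝ} (hg : ∀ k, 0 ≤ g k)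
    (hi : Integrable g ν) (k : ℕ) : ν.real {k} * g k ≤ ∫ j, g j ∂ν := by
  have := setIntegral_le_integral (s := {k}) hi (Eventually.of_forall hg)
  rwa [integral_singleton, smul_eq_mul] at this

lemma norm_sub_sq_of_norm_one {u z : ℂ} (hu : ‖u‖ = 1) (hz : ‖z‖ = 1) :
    ‖u - z‖ ^ 2 = 2 * (1 - (starRingEnd ℂ u * z).re) := by
  rw [← Complex.normSq_eq_norm_sq, Complex.normSq_sub, Complex.normSq_eq_norm_sq,
    Complex.normSq_eq_norm_sq, hu, hz, ← Complex.conj_re, map_mul, Complex.conj_conj]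
  ring

/-- If the characteristic function is close to the unit circle at `t`, then all the values
`exp (itk)` with `k` in the support are close to each other. -/
lemma exists_unit_norm_sub_sq_le [IsProbabilityMeasure ν] (t : ℝ) :
    ∃ u : ℂ, ∀ k : ℕ, ν.real {k} * ‖u - Complex.exp (((t * k : ℝ) : ℂ) * Complex.I)‖ ^ 2 ≤
      2 * (1 - ‖centredCharFun ν t‖) := by
  set w : ℕ → ℂ := fun k => Complex.exp (((t * k : ℝ) : ℂ) * Complex.I)
  have hw : ∀ k, ‖w k‖ = 1 := fun k => Complex.norm_exp_ofReal_mul_I _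
  have hwi : Integrable w ν := integrable_exp ν fun k => t * k
  have hφ : ‖∫ k, w k ∂ν‖ = ‖centredCharFun ν t‖ := by
    have : ∀ k, w k = Complex.exp ((t : ℂ) * Complex.I) *
        Complex.exp (((t * (k - 1) : ℝ) : ℂ) * Complex.I) := by
      intro k
      simp only [w]
      rw [← Complex.exp_add]
      congr 1
      push_cast
      ring
    simp_rw [this]
    rw [integral_const_mul, norm_mul, Complex.norm_exp_ofReal_mul_I, one_mul]
    rfl
  -- With `u` in the direction of the mean `z` of the `w k`, the mean of `‖u - w k‖ ^ 2` is
  -- `2 * (1 - ‖z‖)`.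
  obtain ⟨u, hu, hu'⟩ : ∃ u : ℂ, ‖u‖ = 1 ∧
      (starRingEnd ℂ u) * ∫ k, w k ∂ν = ‖∫ k, w k ∂ν‖ := by
    set z := ∫ k, w k ∂ν
    by_cases hz : z = 0
    · exact ⟨1, by simp, by simp [hz]⟩
    · have hz' : (‖z‖ : ℂ) ≠ 0 := by simpa using hz
      refine ⟨z / ‖z‖, by simp [hz], ?_⟩
      rw [map_div₀, Complex.conj_ofReal, div_mul_eq_mul_div, Complex.conj_mul', sq,
        mul_div_cancel_right₀ _ hz']
  refine ⟨u, fun k => ?_⟩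
  have hre : Integrable (fun k => (starRingEnd ℂ u * w k).re) ν := (hwi.const_mul _).re
  have h1 : ∫ k, ‖u - w k‖ ^ 2 ∂ν = 2 * (1 - ‖centredCharFun ν t‖) := by
    simp_rw [fun k => norm_sub_sq_of_norm_one hu (hw k)]
    rw [integral_const_mul, integral_sub (integrable_const _) hre, integral_const,
      probReal_univ, one_smul]
    congr 2
    have := integral_re (hwi.const_mul (starRingEnd ℂ u))
    rw [integral_const_mul, hu', hφ] at this
    simpa using this
  rw [← h1]
  refine measureReal_mul_le_integral ν (g := fun k => ‖u - w k‖ ^ 2) (fun k => sq_nonneg _) ?_ k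
  simp_rw [fun k => norm_sub_sq_of_norm_one hu (hw k)]
  exact ((integrable_const _).sub hre).const_mul _

lemma one_sub_norm_nonneg [IsProbabilityMeasure ν] (t : ℝ) : 0 ≤ 1 - ‖centredCharFun ν t‖ := by
  have h : ‖centredCharFun ν t‖ ≤ ∫ _, (1 : ℝ) ∂ν :=
    norm_integral_le_of_norm_le (integrable_const _)
      (Eventually.of_forall fun k => by rw [Complex.norm_exp_ofReal_mul_I])
  simpa using h

/-- The subgroup of `ℤ` generated by the support of `ν`. -/
def supportSubgroup : AddSubgroup ℤ :=
  AddSubgroup.closure {d : ℤ | ∃ k : ℕ, ν.real {k} ≠ 0 ∧ (k : ℤ) = d}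

/-- The integers `d` for which such a bound holds, uniformly in `t`, form a subgroup; it contains the
support of `ν`. -/
lemma exists_norm_exp_sub_one_sq_le [IsProbabilityMeasure ν] (h0 : ν.real {0} ≠ 0) {d : ℤ}
    (hd : d ∈ supportSubgroup ν) :
    ∃ C : ℝ, 0 ≤ C ∧ ∀ t : ℝ, ‖Complex.exp (((t * d : ℝ) : ℂ) * Complex.I) - 1‖ ^ 2 ≤
      C * (1 - ‖centredCharFun ν t‖) := by
  induction hd using AddSubgroup.closure_induction with
  | mem d hd =>
    obtain ⟨k, hk, rfl⟩ := hd
    have h0' : 0 < ν.real {0} := lt_of_le_of_ne measureReal_nonneg h0.symm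
    have hk' : 0 < ν.real {k} := lt_of_le_of_ne measureReal_nonneg hk.symm
    refine ⟨4 / ν.real {0} + 4 / ν.real {k}, by positivity, fun t => ?_⟩
    obtain ⟨u, hu⟩ := exists_unit_norm_sub_sq_le ν t
    have e0 := hu 0
    have ek := hu k
    rw [Nat.cast_zero, mul_zero, Complex.ofReal_zero, zero_mul, Complex.exp_zero] at e0
    rw [Int.cast_natCast]
    set w := Complex.exp (((t * k : ℝ) : ℂ) * Complex.I)
    rw [← le_div_iff₀' h0'] at e0
    rw [← le_div_iff₀' hk'] at ek
    have tri : ‖w - 1‖ ≤ ‖u - 1‖ + ‖u - w‖ := by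
      rw [show w - 1 = (u - 1) - (u - w) by ring]
      exact norm_sub_le _ _
    calc ‖w - 1‖ ^ 2 ≤ (‖u - 1‖ + ‖u - w‖) ^ 2 := by gcongr
      _ ≤ 2 * (‖u - 1‖ ^ 2 + ‖u - w‖ ^ 2) := add_sq_le
      _ ≤ 2 * (2 * (1 - ‖centredCharFun ν t‖) / ν.real {0} +
          2 * (1 - ‖centredCharFun ν t‖) / ν.real {k}) := by gcongr
      _ = _ := by ring
  | zero => exact ⟨0, le_rfl, fun t => by simp⟩
  | add x y _ _ hx hy =>
    obtain ⟨C₁, hC₁, h₁⟩ := hx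
    obtain ⟨C₂, hC₂, h₂⟩ := hy
    refine ⟨2 * (C₁ + C₂), by positivity, fun t => ?_⟩
    have hxy : Complex.exp (((t * (x + y : ℤ) : ℝ) : ℂ) * Complex.I) =
        Complex.exp (((t * x : ℝ) : ℂ) * Complex.I) *
          Complex.exp (((t * y : ℝ) : ℂ) * Complex.I) := by
      rw [← Complex.exp_add]; congr 1; push_cast; ring
    rw [hxy]
    have e1 := h₁ t
    have e2 := h₂ t
    have hn : ‖Complex.exp (((t * x : ℝ) : ℂ) * Complex.I)‖ = 1 :=
      Complex.norm_exp_ofReal_mul_I _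
    set z := Complex.exp (((t * x : ℝ) : ℂ) * Complex.I)
    set w := Complex.exp (((t * y : ℝ) : ℂ) * Complex.I)
    have tri : ‖z * w - 1‖ ≤ ‖z - 1‖ + ‖w - 1‖ := by
      rw [show z * w - 1 = z * (w - 1) + (z - 1) by ring]
      refine (norm_add_le _ _).trans_eq ?_
      rw [norm_mul, hn]; ring
    calc ‖z * w - 1‖ ^ 2 ≤ (‖z - 1‖ + ‖w - 1‖) ^ 2 := by gcongr
      _ ≤ 2 * (‖z - 1‖ ^ 2 + ‖w - 1‖ ^ 2) := add_sq_le
      _ ≤ 2 * (C₁ * (1 - ‖centredCharFun ν t‖) + C₂ * (1 - ‖centredCharFun ν t‖)) := by gcongr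
      _ = _ := by ring
  | neg x _ hx =>
    obtain ⟨C, hC, h⟩ := hx
    refine ⟨C, hC, fun t => ?_⟩
    have hn : ‖Complex.exp (((t * x : ℝ) : ℂ) * Complex.I)‖ = 1 :=
      Complex.norm_exp_ofReal_mul_I _
    have hinv : Complex.exp (((t * (-x : ℤ) : ℝ) : ℂ) * Complex.I) *
        Complex.exp (((t * x : ℝ) : ℂ) * Complex.I) = 1 := by
      rw [← Complex.exp_add, ← Complex.exp_zero]; congr 1; push_cast; ring
    have : ‖Complex.exp (((t * (-x : ℤ) : ℝ) : ℂ) * Complex.I) - 1‖ =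
        ‖Complex.exp (((t * x : ℝ) : ℂ) * Complex.I) - 1‖ := by
      rw [← mul_one ‖_ - _‖, ← hn, ← norm_mul, sub_mul, hinv, one_mul, norm_sub_rev]
    rw [this]
    exact h t

lemma norm_exp_mul_I_sub_one_sq (x : ℝ) :
    ‖Complex.exp ((x : ℂ) * Complex.I) - 1‖ ^ 2 = 2 * (1 - cos x) := by
  rw [norm_sub_rev, norm_sub_sq_of_norm_one (by simp) (Complex.norm_exp_ofReal_mul_I x), map_one,
    one_mul, Complex.exp_ofReal_mul_I_re]

/-- Gaussian domination of the characteristic function on a full period. No compactness is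
needed: a Bézout relation expressing the span `h` through the support gives a bound uniform in
`t`. -/
lemma exists_norm_centredCharFun_le [IsProbabilityMeasure ν] (h0 : ν.real {0} ≠ 0) {h : ℕ}
    (hh : 0 < h) (hmem : (h : ℤ) ∈ supportSubgroup ν) :
    ∃ c : ℝ, 0 < c ∧ ∀ t : ℝ, |t| ≤ π / h → ‖centredCharFun ν t‖ ≤ exp (-c * t ^ 2) := by
  obtain ⟨C, hC, hb⟩ := exists_norm_exp_sub_one_sq_le ν h0 hmem
  have hh' : (0 : ℝ) < h := by exact_mod_cast hh
  refine ⟨4 / π ^ 2 * h ^ 2 / (C + 1), by positivity, fun t ht => ?_⟩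
  have e1 := hb t
  rw [norm_exp_mul_I_sub_one_sq, Int.cast_natCast] at e1
  have hth : |t * h| ≤ π := by
    rw [abs_mul, abs_of_pos hh']
    exact (le_div_iff₀ hh').mp ht
  have e2 := cos_le_one_sub_mul_cos_sq hth
  have e3 := one_sub_norm_nonneg ν t
  have e4 : 4 / π ^ 2 * h ^ 2 * t ^ 2 ≤ (1 - ‖centredCharFun ν t‖) * (C + 1) := by
    calc 4 / π ^ 2 * h ^ 2 * t ^ 2 = 2 * (2 / π ^ 2 * (t * h) ^ 2) := by ring
      _ ≤ 2 * (1 - cos (t * h)) := by linarith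
      _ ≤ C * (1 - ‖centredCharFun ν t‖) := e1
      _ ≤ _ := by linarith
  rw [← div_le_iff₀ (by positivity)] at e4
  have e5 := add_one_le_exp (-(4 / π ^ 2 * h ^ 2 / (C + 1)) * t ^ 2)
  have e6 : 4 / π ^ 2 * h ^ 2 * t ^ 2 / (C + 1) = 4 / π ^ 2 * h ^ 2 / (C + 1) * t ^ 2 := by ring
  linarith

/-- The Taylor remainder is at most cubic for `|x| ≤ 1` and at most quadratic for `|x| > 1`, hence
bounded by any power in between. -/
lemma norm_exp_mul_I_sub_taylor_le {δ : ℝ} (hδ : 0 < δ) (hδ1 : δ ≤ 1) (x : ℝ) :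
    ‖Complex.exp ((x : ℂ) * Complex.I) - 1 - x * Complex.I + (x ^ 2 / 2 : ℝ)‖ ≤
      4 * |x| ^ (2 + δ) := by
  by_cases hx : |x| ≤ 1
  · have hn : ‖(x : ℂ) * Complex.I‖ = |x| := by simp
    have h := Complex.exp_bound (x := (x : ℂ) * Complex.I) (by rw [hn]; exact hx)
      (n := 3) (by norm_num)
    rw [hn] at h
    have hs : ∑ m ∈ Finset.range 3, ((x : ℂ) * Complex.I) ^ m / (m.factorial : ℂ) =
        1 + x * Complex.I - (x ^ 2 / 2 : ℝ) := by
      simp [Finset.sum_range_succ, mul_pow, Nat.factorial]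
      ring
    rw [hs] at h
    have h3 : |x| ^ 3 ≤ |x| ^ (2 + δ) := by
      rcases (abs_nonneg x).eq_or_lt with h0 | h0
      · rw [← h0]; simp [Real.rpow_nonneg]
      · rw [← rpow_natCast]
        exact rpow_le_rpow_of_exponent_ge h0 hx (by push_cast; linarith)
    have hp : 0 ≤ |x| ^ 3 := by positivity
    rw [show Complex.exp ((x : ℂ) * Complex.I) - 1 - x * Complex.I + (x ^ 2 / 2 : ℝ) =
      Complex.exp ((x : ℂ) * Complex.I) - (1 + x * Complex.I - (x ^ 2 / 2 : ℝ)) by ring]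
    refine h.trans ?_
    norm_num [Nat.factorial]
    linarith
  · push Not at hx
    have h2 : |x| ^ 2 ≤ |x| ^ (2 + δ) := by
      rw [← rpow_natCast]
      exact rpow_le_rpow_of_exponent_le hx.le (by push_cast; linarith)
    have e1 : ‖Complex.exp ((x : ℂ) * Complex.I)‖ = 1 := Complex.norm_exp_ofReal_mul_I _
    have e2 : ‖(x : ℂ) * Complex.I‖ = |x| := by simp
    have e3 : ‖((x ^ 2 / 2 : ℝ) : ℂ)‖ = |x| ^ 2 / 2 := by
      rw [Complex.norm_real, norm_of_nonneg (by positivity), sq_abs]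
    calc _ ≤ ‖Complex.exp ((x : ℂ) * Complex.I)‖ + ‖(1 : ℂ)‖ + ‖(x : ℂ) * Complex.I‖ +
          ‖((x ^ 2 / 2 : ℝ) : ℂ)‖ :=
        (norm_add_le _ _).trans (by
          gcongr
          exact (norm_sub_le _ _).trans (by gcongr; exact norm_sub_le _ _))
      _ = 1 + 1 + |x| + |x| ^ 2 / 2 := by rw [e1, e2, e3, norm_one]
      _ ≤ 4 * |x| ^ 2 := by nlinarith
      _ ≤ _ := by gcongr

lemma abs_exp_neg_sub_le {u : ℝ} (hu : 0 ≤ u) : |exp (-u) - 1 + u| ≤ u ^ 2 := by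
  have h1 := add_one_le_exp (-u)
  rw [abs_of_nonneg (by linarith)]
  by_cases h : u ≤ 1
  · have := abs_exp_sub_one_sub_id_le (x := -u) (by rwa [abs_neg, abs_of_nonneg hu])
    have := le_of_abs_le this
    nlinarith
  · have : exp (-u) ≤ 1 := exp_le_one_iff.mpr (by linarith)
    nlinarith

/-- Second-order Taylor expansion of the characteristic function under a moment of order
`2 + δ`. -/
lemma exists_norm_centredCharFun_sub_exp_le [IsProbabilityMeasure ν] {δ v a : ℝ} (hδ : 0 < δ)
    (hδ1 : δ ≤ 1) (hv : 0 ≤ v) (ha : 0 < a)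
    (hmean : ∫ k, ((k : ℝ) - 1) ∂ν = 0) (hi1 : Integrable (fun k : ℕ => (k : ℝ) - 1) ν)
    (hvar : ∫ k, ((k : ℝ) - 1) ^ 2 ∂ν = 2 * v)
    (hi2 : Integrable (fun k : ℕ => ((k : ℝ) - 1) ^ 2) ν)
    (hmom : Integrable (fun k : ℕ => |(k : ℝ) - 1| ^ (2 + δ)) ν) :
    ∃ C : ℝ, 0 ≤ C ∧ ∀ t : ℝ, |t| ≤ a →
      ‖centredCharFun ν t - (exp (-v * t ^ 2) : ℝ)‖ ≤ C * |t| ^ (2 + δ) := by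
  set M := ∫ k, |(k : ℝ) - 1| ^ (2 + δ) ∂ν
  have hM : 0 ≤ M := integral_nonneg fun k => by positivity
  refine ⟨4 * M + v ^ 2 * a ^ (2 - δ), by positivity, fun t ht => ?_⟩
  have e1 : centredCharFun ν t - 1 + (v * t ^ 2 : ℝ) =
      ∫ k, (Complex.exp (((t * (k - 1) : ℝ) : ℂ) * Complex.I) - 1
        - (t * ((k : ℝ) - 1) : ℝ) * Complex.I + ((t * ((k : ℝ) - 1)) ^ 2 / 2 : ℝ)) ∂ν := by
    have i1 : Integrable (fun k : ℕ => ((t * ((k : ℝ) - 1) : ℝ) : ℂ) * Complex.I) ν :=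
      (hi1.const_mul t).ofReal.mul_const _
    have i2 : Integrable (fun k : ℕ => (((t * ((k : ℝ) - 1)) ^ 2 / 2 : ℝ) : ℂ)) ν := by
      refine Integrable.ofReal ?_
      simp_rw [mul_pow]
      exact (hi2.const_mul _).div_const _
    have i0 := integrable_exp ν fun k => t * (k - 1)
    have i3 : Integrable (fun k : ℕ =>
        Complex.exp (((t * (k - 1) : ℝ) : ℂ) * Complex.I) - 1) ν := i0.sub (integrable_const _)
    have i4 : Integrable (fun k : ℕ => Complex.exp (((t * (k - 1) : ℝ) : ℂ) * Complex.I) - 1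
        - (t * ((k : ℝ) - 1) : ℝ) * Complex.I) ν := i3.sub i1
    rw [integral_add i4 i2, integral_sub i3 i1, integral_sub i0 (integrable_const _),
      integral_mul_const, integral_complex_ofReal, integral_complex_ofReal, integral_const_mul,
      hmean]
    simp_rw [mul_pow]
    rw [integral_div, integral_const_mul, hvar]
    simp [centredCharFun]
    ring
  have e2 : ‖centredCharFun ν t - 1 + (v * t ^ 2 : ℝ)‖ ≤ 4 * M * |t| ^ (2 + δ) := by
    rw [e1]
    refine (norm_integral_le_of_norm_le
      (g := fun k : ℕ => 4 * |t| ^ (2 + δ) * |(k : ℝ) - 1| ^ (2 + δ)) (hmom.const_mul _)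
      (Eventually.of_forall fun k => ?_)).trans_eq ?_
    · refine (norm_exp_mul_I_sub_taylor_le hδ hδ1 _).trans_eq ?_
      rw [abs_mul, mul_rpow (abs_nonneg _) (abs_nonneg _)]
      ring
    · rw [integral_const_mul]; ring
  have e3 : ‖(((exp (-v * t ^ 2) - 1 + v * t ^ 2 : ℝ)) : ℂ)‖ ≤
      v ^ 2 * a ^ (2 - δ) * |t| ^ (2 + δ) := by
    rw [Complex.norm_real, norm_eq_abs, neg_mul]
    refine (abs_exp_neg_sub_le (by positivity)).trans ?_
    have : t ^ 4 = |t| ^ (2 - δ) * |t| ^ (2 + δ) := by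
      rw [← rpow_add' (abs_nonneg _) (by norm_num), show 2 - δ + (2 + δ) = ((4 : ℕ) : ℝ) by
        push_cast; ring, rpow_natCast, Even.pow_abs (by decide)]
    calc (v * t ^ 2) ^ 2 = v ^ 2 * t ^ 4 := by ring
      _ = v ^ 2 * |t| ^ (2 - δ) * |t| ^ (2 + δ) := by rw [this]; ring
      _ ≤ _ := by
        gcongr
        linarith
  calc ‖centredCharFun ν t - (exp (-v * t ^ 2) : ℝ)‖
      = ‖(centredCharFun ν t - 1 + (v * t ^ 2 : ℝ)) -
          ((exp (-v * t ^ 2) - 1 + v * t ^ 2 : ℝ) : ℂ)‖ := by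
        congr 1; push_cast; ring
    _ ≤ 4 * M * |t| ^ (2 + δ) + v ^ 2 * a ^ (2 - δ) * |t| ^ (2 + δ) :=
        (norm_sub_le _ _).trans (add_le_add e2 e3)
    _ = _ := by ring

end LocalLimit

namespace PlaneTree

open Real LocalLimit

/-! ### Local limit estimates for the random walk -/

lemma walkProb_nonneg (ν : Measure ℕ) (n : ℕ) : ∀ s, 0 ≤ walkProb ν n s := by
  induction n with
  | zero =>
    intro s
    rw [walkProb, pow_zero, PowerSeries.coeff_one]
    split_ifs <;> norm_num
  | succ n ih =>
    intro s
    rw [walkProb_succ]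
    exact Finset.sum_nonneg fun x _ => mul_nonneg measureReal_nonneg (ih _)

lemma walkProb_eq_zero_of_not_dvd (ν : Measure ℕ) {h : ℕ}
    (hdvd : ∀ k, ν.real {k} ≠ 0 → h ∣ k) (n : ℕ) : ∀ s, ¬ h ∣ s → walkProb ν n s = 0 := by
  induction n with
  | zero =>
    intro s hs
    rw [walkProb, pow_zero, PowerSeries.coeff_one, if_neg]
    rintro rfl
    exact hs (dvd_zero h)
  | succ n ih =>
    intro s hs
    rw [walkProb_succ]
    refine Finset.sum_eq_zero fun x hx => ?_
    rw [Finset.HasAntidiagonal.mem_antidiagonal] at hx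
    by_cases h1 : h ∣ x.1
    · rw [ih x.2 (fun h2 => hs (hx ▸ dvd_add h1 h2)), mul_zero]
    · rw [not_not.mp (mt (hdvd x.1) h1), zero_mul]

lemma hasSum_measureReal_smul {E : Type*} [NormedAddCommGroup E] [NormedSpace ℝ E]
    [CompleteSpace E] (ν : Measure ℕ) {g : ℕ → E} (hg : Integrable g ν) :
    HasSum (fun k => ν.real {k} • g k) (∫ k, g k ∂ν) := by
  have h := hasSum_integral_iUnion (μ := ν) (f := g) (s := fun k : ℕ => {k})
    (fun k => .of_discrete) (fun i j hij => by simpa using hij) hg.integrableOn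
  rw [Set.iUnion_of_singleton, setIntegral_univ] at h
  simpa only [integral_singleton] using h

/-- The Fourier series with the walk probabilities as coefficients is a power of the
characteristic function. -/
lemma summable_walkProb_and_tsum (ν : Measure ℕ) [IsProbabilityMeasure ν] (n : ℕ) :
    Summable (walkProb ν n) ∧ ∀ t : ℝ,
      ∑' s, (walkProb ν n s : ℂ) * Complex.exp (((t * s : ℝ) : ℂ) * Complex.I) =
        (Complex.exp ((t : ℂ) * Complex.I) * centredCharFun ν t) ^ n := by
  have hnorm : ∀ (m : ℕ) (t : ℝ) (s : ℕ),
      ‖(walkProb ν m s : ℂ) * Complex.exp (((t * s : ℝ) : ℂ) * Complex.I)‖ = walkProb ν m s := by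
    intro m t s
    rw [norm_mul, Complex.norm_exp_ofReal_mul_I, mul_one, Complex.norm_real,
      norm_of_nonneg (walkProb_nonneg ν m s)]
  induction n with
  | zero =>
    have h0 : ∀ s, s ≠ 0 → walkProb ν 0 s = 0 := fun s hs => by
      rw [walkProb, pow_zero, PowerSeries.coeff_one, if_neg hs]
    refine ⟨summable_of_ne_finset_zero (s := {0}) fun s hs => h0 s (by simpa using hs),
      fun t => ?_⟩
    rw [tsum_eq_single 0 fun s hs => by rw [h0 s hs]; simp]
    simp [walkProb]
  | succ n ih =>
    obtain ⟨hs, ht⟩ := ih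
    have hν : Summable fun k => ν.real {k} := by
      have := (hasSum_measureReal_smul ν (integrable_const (1 : ℝ))).summable
      simpa using this
    have hνnorm : ∀ (t : ℝ) (k : ℕ),
        ‖(ν.real {k} : ℂ) * Complex.exp (((t * k : ℝ) : ℂ) * Complex.I)‖ = ν.real {k} := by
      intro t k
      rw [norm_mul, Complex.norm_exp_ofReal_mul_I, mul_one, Complex.norm_real,
        norm_of_nonneg measureReal_nonneg]
    have hφ : ∀ t : ℝ, ∑' k, (ν.real {k} : ℂ) * Complex.exp (((t * k : ℝ) : ℂ) * Complex.I) =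
        Complex.exp ((t : ℂ) * Complex.I) * centredCharFun ν t := by
      intro t
      rw [centredCharFun, ← integral_const_mul, ← (hasSum_measureReal_smul ν
        ((integrable_exp ν fun k => t * (k - 1)).const_mul _)).tsum_eq]
      refine tsum_congr fun k => ?_
      rw [Complex.real_smul, ← Complex.exp_add]
      congr 2
      push_cast
      ring
    constructor
    · have := summable_norm_sum_mul_antidiagonal_of_summable_norm hν.norm hs.norm
      simp_rw [← walkProb_succ] at this
      exact this.of_norm
    · intro t
      rw [pow_succ', ← ht, ← hφ, tsum_mul_tsum_eq_tsum_sum_antidiagonal_of_summable_norm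
        (by simpa only [hνnorm] using hν) (by simpa only [hnorm] using hs)]
      refine tsum_congr fun s => ?_
      rw [walkProb_succ, Complex.ofReal_sum, Finset.sum_mul]
      refine Finset.sum_congr rfl fun x hx => ?_
      rw [Finset.HasAntidiagonal.mem_antidiagonal] at hx
      have : Complex.exp (((t * s : ℝ) : ℂ) * Complex.I) =
          Complex.exp (((t * x.1 : ℝ) : ℂ) * Complex.I) *
            Complex.exp (((t * x.2 : ℝ) : ℂ) * Complex.I) := by
        rw [← Complex.exp_add, ← hx]; congr 1; push_cast; ring
      rw [this]
      push_cast
      ring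

lemma integral_exp_int_mul {h : ℕ} (hh : 0 < h) {d : ℤ} (hd : d ≠ 0) :
    ∫ t in (-(π / h))..(π / h), Complex.exp (((t * (h * d) : ℝ) : ℂ) * Complex.I) = 0 := by
  have hh' : (h : ℂ) ≠ 0 := by exact_mod_cast hh.ne'
  have hd' : (d : ℂ) ≠ 0 := by exact_mod_cast hd
  have hc : (h * d * Complex.I : ℂ) ≠ 0 :=
    mul_ne_zero (mul_ne_zero hh' hd') Complex.I_ne_zero
  have : ∀ t : ℝ, Complex.exp (((t * (h * d) : ℝ) : ℂ) * Complex.I) =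
      Complex.exp (h * d * Complex.I * t) := fun t => by congr 1; push_cast; ring
  simp_rw [this]
  rw [integral_exp_mul_complex hc, div_eq_zero_iff]
  left
  rw [sub_eq_zero, Complex.exp_eq_exp_iff_exists_int]
  refine ⟨d, ?_⟩
  push_cast
  field_simp
  ring

/-- Fourier inversion for the walk on the lattice `hℤ`. -/
lemma walkProb_eq_fourier (ν : Measure ℕ) [IsProbabilityMeasure ν] {h : ℕ} (hh : 0 < h)
    (hdvd : ∀ k, ν.real {k} ≠ 0 → h ∣ k) {n s j : ℕ} (hs : h ∣ s) (hj : s + j = n) :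
    walkProb ν n s = h / (2 * π) * fourier (centredCharFun ν) (π / h) n j := by
  set ψ := centredCharFun ν
  have hψ : Continuous ψ := continuous_centredCharFun ν
  have hh' : (0 : ℝ) < h := by exact_mod_cast hh
  obtain ⟨hsum, htsum⟩ := summable_walkProb_and_tsum ν n
  have hre : fourier ψ (π / h) n j =
      (∫ t in (-(π / h))..(π / h), ψ t ^ n * Complex.exp (((j : ℝ) : ℂ) * t * Complex.I)).re := by
    have hint : IntervalIntegrable
        (fun t : ℝ => ψ t ^ n * Complex.exp (((j : ℝ) : ℂ) * t * Complex.I)) volume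
        (-(π / h)) (π / h) := by
      apply Continuous.intervalIntegrable
      fun_prop
    exact Complex.reCLM.intervalIntegral_comp_comm hint
  have hseries := intervalIntegral.hasSum_integral_of_dominated_convergence (μ := volume)
    (a := -(π / h)) (b := π / h)
    (F := fun m t => (walkProb ν n m : ℂ) *
      Complex.exp (((t * ((m : ℝ) - s) : ℝ) : ℂ) * Complex.I))
    (f := fun t : ℝ => ψ t ^ n * Complex.exp (((j : ℝ) : ℂ) * t * Complex.I))
    (bound := fun m _ => walkProb ν n m)
    (fun m => (by fun_prop : Continuous fun t : ℝ => (walkProb ν n m : ℂ) *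
      Complex.exp (((t * ((m : ℝ) - s) : ℝ) : ℂ) * Complex.I)).aestronglyMeasurable)
    (fun m => Eventually.of_forall fun t _ => by
      rw [norm_mul, Complex.norm_exp_ofReal_mul_I, mul_one, Complex.norm_real,
        norm_of_nonneg (walkProb_nonneg ν n m)])
    (Eventually.of_forall fun t _ => hsum) (by simp)
    (Eventually.of_forall fun t _ => by
      have hsm : Summable fun m : ℕ =>
          (walkProb ν n m : ℂ) * Complex.exp (((t * m : ℝ) : ℂ) * Complex.I) := by
        refine Summable.of_norm (hsum.congr fun m => ?_)
        rw [norm_mul, Complex.norm_exp_ofReal_mul_I, mul_one, Complex.norm_real,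
          norm_of_nonneg (walkProb_nonneg ν n m)]
      have h1 := hsm.hasSum.mul_right (Complex.exp (((-(t * s) : ℝ) : ℂ) * Complex.I))
      rw [htsum t, mul_pow, mul_right_comm, ← Complex.exp_nat_mul, ← Complex.exp_add,
        mul_comm _ (centredCharFun ν t ^ n)] at h1
      convert! h1 using 1
      · ext m
        rw [mul_assoc, ← Complex.exp_add]
        congr 2
        push_cast
        ring
      · congr 2
        rw [← hj]
        push_cast
        ring)
  have hterm : ∀ m, m ≠ s → ∫ t in (-(π / h))..(π / h), (walkProb ν n m : ℂ) *
      Complex.exp (((t * ((m : ℝ) - s) : ℝ) : ℂ) * Complex.I) = 0 := by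
    intro m hm
    by_cases hhm : h ∣ m
    · obtain ⟨p, rfl⟩ := hhm
      obtain ⟨q, rfl⟩ := hs
      have hpq : (p : ℤ) - q ≠ 0 := by
        intro h0
        apply hm
        rw [show p = q by omega]
      rw [intervalIntegral.integral_const_mul]
      have := integral_exp_int_mul hh hpq
      push_cast at this ⊢
      simp_rw [mul_sub] at this ⊢
      rw [this, mul_zero]
    · rw [walkProb_eq_zero_of_not_dvd ν hdvd n m hhm]
      simp
  have hval := hseries.unique (hasSum_single s hterm)
  rw [hre, hval]
  simp
  field_simp
  ring

/-- A nondegenerate variable with values in `ℕ` and mean one vanishes with positive probability. -/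
lemma measureReal_zero_ne_zero (ν : Measure ℕ) [IsProbabilityMeasure ν]
    (hmean : ∫ k, (k : ℝ) ∂ν = 1) (hi : Integrable (fun k : ℕ => (k : ℝ)) ν)
    (hvar_pos : 0 < variance (fun k : ℕ => (k : ℝ)) ν) : ν.real {0} ≠ 0 := by
  intro h0
  have hae : ∀ᵐ k : ℕ ∂ν, (0 : ℝ) ≤ (k : ℝ) - 1 := by
    have : ∀ᵐ k : ℕ ∂ν, k ≠ 0 := by
      rw [ae_iff]
      simpa [measureReal_eq_zero_iff] using h0
    filter_upwards [this] with k hk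
    have : (1 : ℝ) ≤ k := by exact_mod_cast Nat.one_le_iff_ne_zero.mpr hk
    linarith
  have hz : ∫ k, ((k : ℝ) - 1) ∂ν = 0 := by
    rw [integral_sub hi (integrable_const _), hmean]; simp
  rw [integral_eq_zero_iff_of_nonneg_ae hae (hi.sub (integrable_const _))] at hz
  rw [variance_eq_integral hi.aemeasurable, hmean] at hvar_pos
  have : ∫ k, ((k : ℝ) - 1) ^ 2 ∂ν = 0 := by
    rw [← integral_zero ℕ ℝ (μ := ν)]
    refine integral_congr_ae ?_
    filter_upwards [hz] with k hk
    rw [hk]; simp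
  linarith

/-- The support of the offspring distribution generates a subgroup `hℤ` with `h > 0`. -/
lemma exists_span (ν : Measure ℕ) [IsProbabilityMeasure ν] (hmean : ∫ k, (k : ℝ) ∂ν = 1)
    (hi : Integrable (fun k : ℕ => (k : ℝ)) ν) :
    ∃ h : ℕ, 0 < h ∧ (h : ℤ) ∈ supportSubgroup ν ∧ ∀ k, ν.real {k} ≠ 0 → h ∣ k := by
  obtain ⟨g, hg⟩ := Int.subgroup_cyclic (supportSubgroup ν)
  rw [← AddSubgroup.zmultiples_eq_closure] at hg
  have hdvd : ∀ k, ν.real {k} ≠ 0 → g.natAbs ∣ k := by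
    intro k hk
    have : (k : ℤ) ∈ supportSubgroup ν := AddSubgroup.subset_closure ⟨k, hk, rfl⟩
    rw [hg, Int.mem_zmultiples_iff] at this
    exact Int.natAbs_dvd_natAbs.mpr this
  refine ⟨g.natAbs, ?_, ?_, hdvd⟩
  · rw [Nat.pos_iff_ne_zero]
    intro h0
    have hz : ∀ k : ℕ, ν.real {k} • (k : ℝ) = 0 := by
      intro k
      by_cases hk : ν.real {k} = 0
      · rw [hk, zero_smul]
      · have := hdvd k hk
        rw [h0, zero_dvd_iff] at this
        simp [this]
    have := hasSum_measureReal_smul ν hi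
    simp_rw [hz] at this
    rw [hmean] at this
    exact zero_ne_one (hasSum_zero.unique this)
  · rw [hg, Int.mem_zmultiples_iff]
    exact Int.dvd_natAbs_self

lemma rpow_neg_half_le_two_mul {m : ℕ} (hm : 1 ≤ m) :
    (m : ℝ) ^ (-(1 / 2) : ℝ) ≤ 2 * ((m : ℝ) + 1) ^ (-(1 / 2) : ℝ) := by
  have hm' : (1 : ℝ) ≤ m := by exact_mod_cast hm
  have h4 : (4 : ℝ) ^ (-(1 / 2) : ℝ) = 1 / 2 := by
    rw [show (4 : ℝ) = 2 ^ (2 : ℝ) by norm_num, ← rpow_mul (by norm_num)]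
    norm_num [rpow_neg_one]
  have : (4 * (m : ℝ)) ^ (-(1 / 2) : ℝ) ≤ ((m : ℝ) + 1) ^ (-(1 / 2) : ℝ) :=
    rpow_le_rpow_of_nonpos (by positivity) (by linarith) (by norm_num)
  rw [mul_rpow (by norm_num) (by positivity), h4] at this
  linarith

/-- Local limit estimates for the random walk whose steps have a finite moment of order `2 + δ`:
upper bounds, a lower bound along admissible sizes, and the increment bound. -/
theorem exists_walkProb_bounds (ν : Measure ℕ) [IsProbabilityMeasure ν]
    (hmean : ∫ k, (k : ℝ) ∂ν = 1)
    (hvar_fin : MemLp (fun k : ℕ => (k : ℝ)) 2 ν)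
    (hvar_pos : 0 < variance (fun k : ℕ => (k : ℝ)) ν) {δ : ℝ} (hδ : 0 < δ) (hδ1 : δ ≤ 1)
    (hmom : Integrable (fun k : ℕ => (k : ℝ) ^ (2 + δ)) ν) :
    ∃ K κ : ℝ, 0 ≤ K ∧ 0 < κ ∧
      (∀ m, walkProb ν m m ≤ K * ((m : ℝ) + 1) ^ (-(1 / 2) : ℝ)) ∧
      (∀ n ∈ admissible ν, walkProb ν n (n - 1) ≤ K * (n : ℝ) ^ (-(1 / 2) : ℝ)) ∧
      (∀ᶠ n in atTop, n ∈ admissible ν →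
        κ * (n : ℝ) ^ (-(1 / 2) : ℝ) ≤ walkProb ν n (n - 1)) ∧
      (∀ n ∈ admissible ν, ∀ k ∈ admissible ν, 2 * k ≤ n →
        |walkProb ν (n - k) (n - k) - walkProb ν n (n - 1)| ≤
          K * (k * (n : ℝ) ^ (-(3 / 2) : ℝ) + (n : ℝ) ^ (-1 - δ / 2))) := by
  have hi : Integrable (fun k : ℕ => (k : ℝ)) ν := hvar_fin.integrable (by norm_num)
  have h0 := measureReal_zero_ne_zero ν hmean hi hvar_pos
  obtain ⟨h, hh, hmem, hdvd⟩ := exists_span ν hmean hi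
  have hh' : (0 : ℝ) < h := by exact_mod_cast hh
  set a := π / h with ha_def
  have ha : 0 < a := by positivity
  set v := variance (fun k : ℕ => (k : ℝ)) ν / 2 with hv_def
  have hv : 0 < v := by positivity
  obtain ⟨c₀, hc₀, hE₀⟩ := exists_norm_centredCharFun_le ν h0 hh hmem
  set c := min c₀ v with hc_def
  have hc : 0 < c := lt_min hc₀ hv
  have hcv : c ≤ v := min_le_right _ _
  have hE : ∀ t, |t| ≤ a → ‖centredCharFun ν t‖ ≤ exp (-c * t ^ 2) := by
    intro t ht
    refine (hE₀ t ht).trans (exp_le_exp.mpr ?_)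
    have : c ≤ c₀ := min_le_left _ _
    nlinarith [sq_nonneg t]
  have hi1 : Integrable (fun k : ℕ => (k : ℝ) - 1) ν := hi.sub (integrable_const _)
  have hi2 : Integrable (fun k : ℕ => ((k : ℝ) - 1) ^ 2) ν :=
    (hvar_fin.sub (memLp_const 1)).integrable_sq
  have hmean1 : ∫ k, ((k : ℝ) - 1) ∂ν = 0 := by
    rw [integral_sub hi (integrable_const _), hmean]; simp
  have hvar2 : ∫ k, ((k : ℝ) - 1) ^ 2 ∂ν = 2 * v := by
    rw [hv_def, variance_eq_integral hi.aemeasurable, hmean]; ring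
  have hmom1 : Integrable (fun k : ℕ => |(k : ℝ) - 1| ^ (2 + δ)) ν := by
    refine (hmom.add (integrable_const 1)).mono' (Measurable.of_discrete).aestronglyMeasurable
      (Eventually.of_forall fun k => ?_)
    rw [norm_of_nonneg (by positivity), Pi.add_apply]
    rcases Nat.eq_zero_or_pos k with rfl | hk
    · simp [Real.zero_rpow (show 2 + δ ≠ 0 by positivity)]
    · have hk' : (1 : ℝ) ≤ k := by exact_mod_cast hk
      rw [abs_of_nonneg (by linarith)]
      have : ((k : ℝ) - 1) ^ (2 + δ) ≤ (k : ℝ) ^ (2 + δ) :=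
        rpow_le_rpow (by linarith) (by linarith) (by positivity)
      linarith
  obtain ⟨C, hC, hD⟩ := exists_norm_centredCharFun_sub_exp_le ν hδ hδ1 hv.le ha hmean1 hi1 hvar2
    hi2 hmom1
  have hψ := continuous_centredCharFun ν
  obtain ⟨K₁, hK₁, b₁⟩ := exists_abs_fourier_le ha hc hE
  obtain ⟨κ, hκ, b₂⟩ := exists_le_fourier_one hψ ha hc hcv hC hδ hE hD
  obtain ⟨K₂, hK₂, b₃⟩ := exists_abs_fourier_sub_le hψ ha hc hcv hC hδ hE hD
  set H := h / (2 * π) with hH_def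
  have hH : 0 < H := by positivity
  -- By the Otter–Dwass formula, admissible sizes are congruent to `1` modulo the span `h`.
  have hadm : ∀ n ∈ admissible ν, h ∣ n - 1 := by
    intro n hn
    by_contra hnd
    have h1 := one_le_of_mem_admissible ν hn
    have h2 := mul_treeMean_one ν h1
    rw [walkProb_eq_zero_of_not_dvd ν hdvd n _ hnd] at h2
    have h3 := treeMean_one_pos ν hn
    have h4 : (0 : ℝ) < n := by exact_mod_cast h1
    have := mul_pos h4 h3
    linarith
  have hone : ∀ n ∈ admissible ν,
      walkProb ν n (n - 1) = H * fourier (centredCharFun ν) a n 1 := by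
    intro n hn
    have := walkProb_eq_fourier ν hh hdvd (hadm n hn)
      (Nat.sub_add_cancel (one_le_of_mem_admissible ν hn))
    simpa using this
  have hzero : ∀ m, h ∣ m → walkProb ν m m = H * fourier (centredCharFun ν) a m 0 := by
    intro m hm
    have := walkProb_eq_fourier ν hh hdvd hm (add_zero m)
    simpa using this
  refine ⟨max (2 * (H * K₁) + 1) (H * K₂), H * κ, by positivity, by positivity, ?_, ?_, ?_, ?_⟩
  · intro m
    have hp : 0 < ((m : ℝ) + 1) ^ (-(1 / 2) : ℝ) := by positivity
    have hle : (2 * (H * K₁) + 1) * ((m : ℝ) + 1) ^ (-(1 / 2) : ℝ) ≤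
        max (2 * (H * K₁) + 1) (H * K₂) * ((m : ℝ) + 1) ^ (-(1 / 2) : ℝ) := by
      gcongr; exact le_max_left _ _
    refine le_trans ?_ hle
    rcases Nat.eq_zero_or_pos m with rfl | hm
    · have : 0 ≤ H * K₁ := by positivity
      simp [walkProb]
      linarith
    by_cases hhm : h ∣ m
    · rw [hzero m hhm]
      have e1 := (le_abs_self _).trans (b₁ m 0 hm)
      have e2 := rpow_neg_half_le_two_mul hm
      calc H * fourier (centredCharFun ν) a m 0
          ≤ H * (K₁ * (2 * ((m : ℝ) + 1) ^ (-(1 / 2) : ℝ))) := by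
            gcongr
            exact e1.trans (by gcongr)
        _ ≤ _ := by linarith
    · rw [walkProb_eq_zero_of_not_dvd ν hdvd m m hhm]
      positivity
  · intro n hn
    have e1 := (le_abs_self _).trans (b₁ n 1 (one_le_of_mem_admissible ν hn))
    rw [hone n hn]
    have hHK : H * K₁ ≤ max (2 * (H * K₁) + 1) (H * K₂) := by
      refine le_trans ?_ (le_max_left _ _)
      have : 0 ≤ H * K₁ := by positivity
      linarith
    calc H * fourier (centredCharFun ν) a n 1
        ≤ H * (K₁ * (n : ℝ) ^ (-(1 / 2) : ℝ)) := by gcongr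
      _ = H * K₁ * (n : ℝ) ^ (-(1 / 2) : ℝ) := by ring
      _ ≤ _ := by gcongr
  · filter_upwards [b₂] with n hn hna
    rw [hone n hna, mul_assoc]
    gcongr
  · intro n hn k hk hkn
    have hk1 := one_le_of_mem_admissible ν hk
    have hnk : h ∣ n - k := by
      have := Nat.dvd_sub (hadm n hn) (hadm k hk)
      rwa [show n - 1 - (k - 1) = n - k by omega] at this
    rw [hone n hn, hzero _ hnk, ← mul_sub, abs_mul, abs_of_pos hH]
    calc H * _ ≤ H * (K₂ * (k * (n : ℝ) ^ (-(3 / 2) : ℝ) + (n : ℝ) ^ (-1 - δ / 2))) := by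
          gcongr; exact b₃ n k hk1 hkn
      _ = H * K₂ * (k * (n : ℝ) ^ (-(3 / 2) : ℝ) + (n : ℝ) ^ (-1 - δ / 2)) := by ring
      _ ≤ _ := by gcongr; exact le_max_right _ _

/-! ### Sums of powers and the comparison of the convolution with its limit -/

/-- Bernoulli's inequality in the form of a lower bound for the increments of `x ↦ x ^ s`. -/
lemma mul_rpow_le_rpow_succ_sub {s : ℝ} (hs : 0 < s) (hs1 : s ≤ 1) (m : ℕ) :
    s * ((m : ℝ) + 1) ^ (s - 1) ≤ ((m : ℝ) + 1) ^ s - (m : ℝ) ^ s := by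
  have hm : (0 : ℝ) < (m : ℝ) + 1 := by positivity
  have hle : 1 / ((m : ℝ) + 1) ≤ 1 := by
    rw [div_le_one hm]
    have : (0 : ℝ) ≤ m := Nat.cast_nonneg m
    linarith
  have h1 : (1 + -(1 / ((m : ℝ) + 1))) ^ s ≤ 1 + s * -(1 / ((m : ℝ) + 1)) :=
    rpow_one_add_le_one_add_mul_self (by linarith) hs.le hs1
  have h2 : (m : ℝ) = ((m : ℝ) + 1) * (1 + -(1 / ((m : ℝ) + 1))) := by field_simp; ring
  have h3 : (m : ℝ) ^ s = ((m : ℝ) + 1) ^ s * (1 + -(1 / ((m : ℝ) + 1))) ^ s := by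
    conv_lhs => rw [h2]
    exact mul_rpow hm.le (by linarith)
  rw [h3, rpow_sub_one hm.ne']
  have h4 := mul_le_mul_of_nonneg_left h1 (rpow_nonneg hm.le s)
  have h5 : s * (((m : ℝ) + 1) ^ s / ((m : ℝ) + 1)) =
      ((m : ℝ) + 1) ^ s - ((m : ℝ) + 1) ^ s * (1 + s * -(1 / ((m : ℝ) + 1))) := by
    field_simp; ring
  rw [h5]
  linarith

lemma sum_range_rpow_le {s : ℝ} (hs : 0 < s) (hs1 : s ≤ 1) (n : ℕ) :
    ∑ m ∈ Finset.range n, ((m : ℝ) + 1) ^ (s - 1) ≤ (n : ℝ) ^ s / s := by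
  rw [le_div_iff₀' hs, Finset.mul_sum]
  refine (Finset.sum_le_sum fun m _ => mul_rpow_le_rpow_succ_sub hs hs1 m).trans_eq ?_
  have := Finset.sum_range_sub (fun m : ℕ => (m : ℝ) ^ s) n
  push_cast at this
  rw [this, zero_rpow hs.ne', sub_zero]

lemma rpow_neg_three_halves_le {m : ℕ} (hm : 1 ≤ m) :
    ((m : ℝ) + 1) ^ (-(3 / 2) : ℝ) ≤
      2 * ((m : ℝ) ^ (-(1 / 2) : ℝ) - ((m : ℝ) + 1) ^ (-(1 / 2) : ℝ)) := by
  have hm0 : (0 : ℝ) < m := by exact_mod_cast hm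
  have hm1 : (0 : ℝ) < (m : ℝ) + 1 := by positivity
  set x := √(m : ℝ) with hx
  set y := √((m : ℝ) + 1) with hy
  have hx0 : 0 < x := sqrt_pos.mpr hm0
  have hy0 : 0 < y := sqrt_pos.mpr hm1
  have hxy : x ≤ y := sqrt_le_sqrt (by linarith)
  have hsq : y ^ 2 - x ^ 2 = 1 := by rw [sq_sqrt hm1.le, sq_sqrt hm0.le]; ring
  have e1 : (m : ℝ) ^ (-(1 / 2) : ℝ) = 1 / x := by
    rw [rpow_neg hm0.le, ← sqrt_eq_rpow, one_div]
  have e2 : ((m : ℝ) + 1) ^ (-(1 / 2) : ℝ) = 1 / y := by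
    rw [rpow_neg hm1.le, ← sqrt_eq_rpow, one_div]
  have e3 : ((m : ℝ) + 1) ^ (-(3 / 2) : ℝ) = 1 / y ^ 3 := by
    rw [rpow_neg hm1.le, hy, sqrt_eq_rpow, ← rpow_natCast, ← rpow_mul hm1.le, one_div]
    norm_num
  rw [e1, e2, e3]
  have e4 : 2 * (1 / x - 1 / y) - 1 / y ^ 3 =
      (2 * y ^ 2 * (y - x) - x) / (x * y ^ 3) := by field_simp
  have e5 : 0 ≤ 2 * y ^ 2 * (y - x) - x := by
    have h1 : (y - x) * (y + x) = 1 := by linear_combination hsq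
    have h2 : 1 ≤ (y - x) * (2 * y) := by nlinarith
    nlinarith
  have e6 : 0 ≤ (2 * y ^ 2 * (y - x) - x) / (x * y ^ 3) := by positivity
  linarith

lemma sum_range_rpow_neg_three_halves_le {n : ℕ} (hn : 1 ≤ n) (N : ℕ) :
    ∑ k ∈ Finset.range N, ((k + (n + 1) : ℕ) : ℝ) ^ (-(3 / 2) : ℝ) ≤
      2 * (n : ℝ) ^ (-(1 / 2) : ℝ) := by
  have hle : ∀ k ∈ Finset.range N, ((k + (n + 1) : ℕ) : ℝ) ^ (-(3 / 2) : ℝ) ≤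
      2 * (((k + n : ℕ) : ℝ) ^ (-(1 / 2) : ℝ) - ((k + 1 + n : ℕ) : ℝ) ^ (-(1 / 2) : ℝ)) := by
    intro k _
    have := rpow_neg_three_halves_le (show 1 ≤ k + n by omega)
    convert this using 4 <;> push_cast <;> ring
  refine (Finset.sum_le_sum hle).trans ?_
  rw [← Finset.mul_sum,
    Finset.sum_range_sub' (fun k => ((k + n : ℕ) : ℝ) ^ (-(1 / 2) : ℝ)), zero_add]
  have : 0 ≤ ((N + n : ℕ) : ℝ) ^ (-(1 / 2) : ℝ) := by positivity
  linarith

/-- The tail of a series whose terms are `O(k ^ (-3/2 - δ/2))`. -/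
lemma mul_abs_tail_le {g : ℕ → ℝ} {B δ : ℝ} (hδ : 0 < δ) (hB : 0 ≤ B)
    (hg : ∀ k : ℕ, 1 ≤ k → |g k| ≤ B * (k : ℝ) ^ (-(3 / 2) - δ / 2)) {n : ℕ} (hn : 1 ≤ n) :
    n * |∑' k, g (k + (n + 1))| ≤ 2 * B * (n : ℝ) ^ ((1 - δ) / 2) := by
  have hn0 : (0 : ℝ) < n := by exact_mod_cast hn
  have hterm : ∀ k : ℕ, ‖g (k + (n + 1))‖ ≤
      B * (n : ℝ) ^ (-(δ / 2)) * ((k + (n + 1) : ℕ) : ℝ) ^ (-(3 / 2) : ℝ) := by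
    intro k
    have hk0 : (0 : ℝ) < ((k + (n + 1) : ℕ) : ℝ) := by positivity
    have hkn : (n : ℝ) ≤ ((k + (n + 1) : ℕ) : ℝ) := by exact_mod_cast (by omega)
    refine (hg _ (by omega)).trans ?_
    rw [show -(3 / 2) - δ / 2 = -(δ / 2) + -(3 / 2) by ring, rpow_add hk0, ← mul_assoc]
    gcongr ?_ * _
    refine mul_le_mul_of_nonneg_left ?_ hB
    exact rpow_le_rpow_of_nonpos hn0 hkn (by linarith)
  have hpart : ∀ N, ∑ k ∈ Finset.range N, ‖g (k + (n + 1))‖ ≤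
      B * (n : ℝ) ^ (-(δ / 2)) * (2 * (n : ℝ) ^ (-(1 / 2) : ℝ)) := by
    intro N
    refine (Finset.sum_le_sum fun k _ => hterm k).trans ?_
    rw [← Finset.mul_sum]
    gcongr
    exact sum_range_rpow_neg_three_halves_le hn N
  have hsum : Summable fun k => ‖g (k + (n + 1))‖ :=
    summable_of_sum_range_le (fun _ => norm_nonneg _) hpart
  have htail : |∑' k, g (k + (n + 1))| ≤
      B * (n : ℝ) ^ (-(δ / 2)) * (2 * (n : ℝ) ^ (-(1 / 2) : ℝ)) :=
    (norm_tsum_le_tsum_norm hsum).trans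
      (Real.tsum_le_of_sum_range_le (fun _ => norm_nonneg _) hpart)
  calc n * |∑' k, g (k + (n + 1))|
      ≤ n * (B * (n : ℝ) ^ (-(δ / 2)) * (2 * (n : ℝ) ^ (-(1 / 2) : ℝ))) := by gcongr
    _ = 2 * B * ((n : ℝ) ^ (1 : ℝ) * (n : ℝ) ^ (-(δ / 2)) * (n : ℝ) ^ (-(1 / 2) : ℝ)) := by
        rw [rpow_one]; ring
    _ = 2 * B * (n : ℝ) ^ ((1 - δ) / 2) := by
        rw [← rpow_add hn0, ← rpow_add hn0]
        congr 2; ring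

/-- Comparison of `n / b n * ∑ g k * A (n - k)` with `n * ∑ g k`. For `k ≤ n / 2` the increment
bound on `A (n - k) - b n` is used, for `k > n / 2` the decay of `g`, and the indices `k > n`
contribute only a tail. -/
lemma exists_abs_convolution_sub_le {S : Set ℕ} {A b g : ℕ → ℝ} {K κ B δ μ : ℝ}
    (hδ : 0 < δ) (hδ1 : δ ≤ 1) (hK : 0 ≤ K) (hκ : 0 < κ) (hB : 0 ≤ B)
    (hS : ∀ n ∈ S, 1 ≤ n) (hA0 : ∀ m, 0 ≤ A m) (hb0 : ∀ n, 0 ≤ b n)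
    (hA : ∀ m : ℕ, A m ≤ K * ((m : ℝ) + 1) ^ (-(1 / 2) : ℝ))
    (hb : ∀ n ∈ S, b n ≤ K * (n : ℝ) ^ (-(1 / 2) : ℝ))
    (hlow : ∀ᶠ n : ℕ in atTop, n ∈ S → κ * (n : ℝ) ^ (-(1 / 2) : ℝ) ≤ b n)
    (hdiff : ∀ n ∈ S, ∀ k ∈ S, 2 * k ≤ n →
      |A (n - k) - b n| ≤ K * (k * (n : ℝ) ^ (-(3 / 2) : ℝ) + (n : ℝ) ^ (-1 - δ / 2)))
    (hgS : ∀ k, k ∉ S → g k = 0) (hgμ : HasSum g μ)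
    (hg : ∀ k : ℕ, 1 ≤ k → |g k| ≤ B * (k : ℝ) ^ (-(3 / 2) - δ / 2))
    (hsum : ∀ n : ℕ, 1 ≤ n →
      ∑ k ∈ Finset.range (n + 1), k * |g k| ≤ B * (n : ℝ) ^ ((1 - δ) / 2)) :
    ∃ D : ℝ, ∀ᶠ n : ℕ in atTop, n ∈ S →
      |n / b n * ∑ x ∈ Finset.HasAntidiagonal.antidiagonal n, g x.1 * A x.2 - n * μ| ≤
        D * (n : ℝ) ^ ((1 - δ) / 2) := by
  have hgabs : Summable fun k => |g k| := hgμ.summable.abs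
  set G := ∑' k, |g k|
  have hG : 0 ≤ G := tsum_nonneg fun k => abs_nonneg _
  refine ⟨(K * B + K * G + 32 * K * B) / κ + 2 * B, ?_⟩
  filter_upwards [hlow] with n hlow hnS
  have hbn := hlow hnS
  have hn := hS n hnS
  have hn0 : (0 : ℝ) < n := by exact_mod_cast hn
  have hn1 : (1 : ℝ) ≤ n := by exact_mod_cast hn
  have hbpos : 0 < b n := lt_of_lt_of_le (by positivity) hbn
  have hterm : ∀ k ∈ Finset.range (n + 1), |g k * (A (n - k) - b n)| ≤
      K * (n : ℝ) ^ (-(3 / 2) : ℝ) * (k * |g k|) + K * (n : ℝ) ^ (-1 - δ / 2) * |g k| +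
        8 * K * B * (n : ℝ) ^ (-(3 / 2) - δ / 2) * (((n - k : ℕ) : ℝ) + 1) ^ (-(1 / 2) : ℝ) := by
    intro k hk
    rw [Finset.mem_range] at hk
    have p1 : 0 ≤ K * (n : ℝ) ^ (-(3 / 2) : ℝ) * (k * |g k|) := by positivity
    have p2 : 0 ≤ K * (n : ℝ) ^ (-1 - δ / 2) * |g k| := by positivity
    have p3 : 0 ≤ 8 * K * B * (n : ℝ) ^ (-(3 / 2) - δ / 2) *
        (((n - k : ℕ) : ℝ) + 1) ^ (-(1 / 2) : ℝ) := by positivity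
    by_cases hkS : k ∈ S
    swap
    · rw [hgS k hkS] at p1 p2 ⊢
      rw [zero_mul, abs_zero]
      simpa using p3
    have hk1 := hS k hkS
    have hk0 : (0 : ℝ) < k := by exact_mod_cast hk1
    rw [abs_mul]
    by_cases hkn : 2 * k ≤ n
    · have := mul_le_mul_of_nonneg_left (hdiff n hnS k hkS hkn) (abs_nonneg (g k))
      calc |g k| * |A (n - k) - b n| ≤ _ := this
        _ = K * (n : ℝ) ^ (-(3 / 2) : ℝ) * (k * |g k|) +
            K * (n : ℝ) ^ (-1 - δ / 2) * |g k| := by ring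
        _ ≤ _ := by linarith
    · -- Here `n < 2 * k`: the increment is bounded crudely, and `4` bounds `2 ^ (3/2 + δ/2)`.
      have e1 : (n : ℝ) ^ (-(1 / 2) : ℝ) ≤ (((n - k : ℕ) : ℝ) + 1) ^ (-(1 / 2) : ℝ) := by
        refine rpow_le_rpow_of_nonpos (by positivity) ?_ (by norm_num)
        exact_mod_cast (by omega)
      have e2 : |A (n - k) - b n| ≤ 2 * K * (((n - k : ℕ) : ℝ) + 1) ^ (-(1 / 2) : ℝ) := by
        have a1 := hA (n - k)
        have a2 := (hb n hnS).trans (mul_le_mul_of_nonneg_left e1 hK)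
        have a3 := hA0 (n - k)
        have a4 := hb0 n
        rw [abs_le]
        constructor <;> linarith
      have e3 : |g k| ≤ 4 * B * (n : ℝ) ^ (-(3 / 2) - δ / 2) := by
        refine (hg k hk1).trans ?_
        have h2 : (2 : ℝ) ^ (-(3 / 2) - δ / 2) ≥ 1 / 4 := by
          calc (1 / 4 : ℝ) = 2 ^ (-2 : ℝ) := by norm_num [rpow_neg]
            _ ≤ _ := rpow_le_rpow_of_exponent_le (by norm_num) (by linarith)
        have h3 : (2 * (k : ℝ)) ^ (-(3 / 2) - δ / 2) ≤ (n : ℝ) ^ (-(3 / 2) - δ / 2) :=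
          rpow_le_rpow_of_nonpos hn0 (by exact_mod_cast (by omega)) (by linarith)
        rw [mul_rpow (by norm_num) hk0.le] at h3
        have hkp : 0 ≤ (k : ℝ) ^ (-(3 / 2) - δ / 2) := by positivity
        have h4 : (k : ℝ) ^ (-(3 / 2) - δ / 2) ≤ 4 * (n : ℝ) ^ (-(3 / 2) - δ / 2) := by
          nlinarith
        nlinarith
      calc |g k| * |A (n - k) - b n| ≤ (4 * B * (n : ℝ) ^ (-(3 / 2) - δ / 2)) *
            (2 * K * (((n - k : ℕ) : ℝ) + 1) ^ (-(1 / 2) : ℝ)) := by gcongr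
        _ = 8 * K * B * (n : ℝ) ^ (-(3 / 2) - δ / 2) *
            (((n - k : ℕ) : ℝ) + 1) ^ (-(1 / 2) : ℝ) := by ring
        _ ≤ _ := by linarith
  have hhalf : ∑ k ∈ Finset.range (n + 1), (((n - k : ℕ) : ℝ) + 1) ^ (-(1 / 2) : ℝ) ≤
      4 * (n : ℝ) ^ (1 / 2 : ℝ) := by
    have h1 := Finset.sum_range_reflect (fun m : ℕ => ((m : ℝ) + 1) ^ (-(1 / 2) : ℝ)) (n + 1)
    rw [Nat.add_sub_cancel] at h1
    rw [h1]
    have h2 := sum_range_rpow_le (s := 1 / 2) (by norm_num) (by norm_num) (n + 1)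
    rw [show (1 / 2 - 1 : ℝ) = -(1 / 2) by norm_num] at h2
    refine h2.trans ?_
    have h3 : ((n + 1 : ℕ) : ℝ) ^ (1 / 2 : ℝ) ≤ (4 * (n : ℝ)) ^ (1 / 2 : ℝ) := by
      refine rpow_le_rpow (by positivity) ?_ (by norm_num)
      push_cast; linarith
    have h4 : (4 : ℝ) ^ (1 / 2 : ℝ) = 2 := by
      rw [← sqrt_eq_rpow, show (4 : ℝ) = 2 ^ 2 by norm_num, sqrt_sq (by norm_num)]
    rw [mul_rpow (by norm_num) hn0.le, h4] at h3
    linarith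
  have hmain : |∑ k ∈ Finset.range (n + 1), g k * (A (n - k) - b n)| ≤
      (K * B + K * G + 32 * K * B) * (n : ℝ) ^ (-1 - δ / 2) := by
    refine (Finset.abs_sum_le_sum_abs _ _).trans ((Finset.sum_le_sum hterm).trans ?_)
    rw [Finset.sum_add_distrib, Finset.sum_add_distrib, ← Finset.mul_sum, ← Finset.mul_sum,
      ← Finset.mul_sum]
    have hGle : ∑ k ∈ Finset.range (n + 1), |g k| ≤ G :=
      hgabs.sum_le_tsum _ fun _ _ => abs_nonneg _
    have r1 : (n : ℝ) ^ (-(3 / 2) : ℝ) * (n : ℝ) ^ ((1 - δ) / 2) = (n : ℝ) ^ (-1 - δ / 2) := by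
      rw [← rpow_add hn0]; congr 1; ring
    have r2 : (n : ℝ) ^ (-(3 / 2) - δ / 2) * (n : ℝ) ^ (1 / 2 : ℝ) =
        (n : ℝ) ^ (-1 - δ / 2) := by
      rw [← rpow_add hn0]; congr 1; ring
    calc _ ≤ K * (n : ℝ) ^ (-(3 / 2) : ℝ) * (B * (n : ℝ) ^ ((1 - δ) / 2)) +
          K * (n : ℝ) ^ (-1 - δ / 2) * G +
          8 * K * B * (n : ℝ) ^ (-(3 / 2) - δ / 2) * (4 * (n : ℝ) ^ (1 / 2 : ℝ)) := by
          gcongr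
          exact hsum n hn
      _ = _ := by linear_combination (K * B) * r1 + (32 * K * B) * r2
  have htail := mul_abs_tail_le hδ hB hg hn
  have hsplit : n / b n * ∑ x ∈ Finset.HasAntidiagonal.antidiagonal n, g x.1 * A x.2 - n * μ =
      n / b n * ∑ k ∈ Finset.range (n + 1), g k * (A (n - k) - b n) -
        n * ∑' k, g (k + (n + 1)) := by
    rw [← hgμ.tsum_eq, ← hgμ.summable.sum_add_tsum_nat_add (n + 1),
      Finset.Nat.sum_antidiagonal_eq_sum_range_succ_mk]
    simp_rw [mul_sub]
    rw [Finset.sum_sub_distrib, ← Finset.sum_mul]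
    field_simp
    ring
  have hnb : n / b n ≤ (n : ℝ) ^ (3 / 2 : ℝ) / κ := by
    rw [div_le_div_iff₀ hbpos hκ]
    have r : (n : ℝ) ^ (3 / 2 : ℝ) * (n : ℝ) ^ (-(1 / 2) : ℝ) = n := by
      rw [← rpow_add hn0]; norm_num
    calc (n : ℝ) * κ = (n : ℝ) ^ (3 / 2 : ℝ) * (κ * (n : ℝ) ^ (-(1 / 2) : ℝ)) := by
          linear_combination -κ * r
      _ ≤ _ := by gcongr
  rw [hsplit]
  refine (abs_sub _ _).trans ?_
  rw [abs_mul, abs_mul, abs_of_pos hn0, abs_of_pos (by positivity : (0 : ℝ) < n / b n), add_mul]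
  refine add_le_add ?_ htail
  have r3 : (n : ℝ) ^ (3 / 2 : ℝ) * (n : ℝ) ^ (-1 - δ / 2) = (n : ℝ) ^ ((1 - δ) / 2) := by
    rw [← rpow_add hn0]; congr 1; ring
  calc _ ≤ (n : ℝ) ^ (3 / 2 : ℝ) / κ * ((K * B + K * G + 32 * K * B) * (n : ℝ) ^ (-1 - δ / 2)) := by
        gcongr
    _ = _ := by rw [← r3]; ring

/-! ### The expectation of an additive functional of a conditioned tree -/

lemma integral_additive_condGW (ν : Measure ℕ) [IsFiniteMeasure ν] (f : PlaneTree → ℝ) {n : ℕ}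
    (hn : n ∈ admissible ν) :
    ∫ t, additive f t ∂(condGW ν n) = n / walkProb ν n (n - 1) *
      ∑ x ∈ Finset.HasAntidiagonal.antidiagonal n, treeMean ν f x.1 * walkProb ν x.2 x.2 := by
  have h1 := one_le_of_mem_admissible ν hn
  have h2 := treeMean_one_pos ν hn
  have h3 : (n : ℝ) ≠ 0 := by positivity
  rw [integral_condGW, ← treeMean_additive, ← mul_treeMean_one ν h1]
  field_simp

lemma treeMean_one_le (ν : Measure ℕ) [IsFiniteMeasure ν] {K : ℝ}
    (hK : ∀ n ∈ admissible ν, walkProb ν n (n - 1) ≤ K * (n : ℝ) ^ (-(1 / 2) : ℝ)) {n : ℕ}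
    (hn : n ∈ admissible ν) :
    treeMean ν (fun _ => 1) n ≤ K * (n : ℝ) ^ (-(3 / 2) : ℝ) := by
  have h1 := one_le_of_mem_admissible ν hn
  have hn0 : (0 : ℝ) < n := by exact_mod_cast h1
  have h2 := hK n hn
  rw [← mul_treeMean_one ν h1] at h2
  have r : (n : ℝ) * (n : ℝ) ^ (-(3 / 2) : ℝ) = (n : ℝ) ^ (-(1 / 2) : ℝ) := by
    rw [← rpow_one_add' hn0.le (by norm_num)]; norm_num
  rw [← r] at h2
  refine le_of_mul_le_mul_left (h2.trans_eq ?_) hn0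
  ring

/-- Both parts of the theorem at once: they differ only in the way in which the partial sums of
`k * E[f(𝒯); |𝒯| = k]` are controlled. -/
theorem isBigO_integral_additive_sub (ν : Measure ℕ) [IsProbabilityMeasure ν]
    (hmean : ∫ k, (k : ℝ) ∂ν = 1)
    (hvar_fin : MemLp (fun k : ℕ => (k : ℝ)) 2 ν)
    (hvar_pos : 0 < variance (fun k : ℕ => (k : ℝ)) ν)
    (f : PlaneTree → ℝ) (hf : Integrable f (gwLaw ν)) {δ : ℝ} (hδ : 0 < δ) (hδ1 : δ ≤ 1)
    (hmom : Integrable (fun k : ℕ => (k : ℝ) ^ (2 + δ)) ν)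
    (hO : (fun n : ℕ => ∫ t, f t ∂(condGW ν n)) =O[admissibleAtTop ν]
      (fun n : ℕ => (n : ℝ) ^ (-δ / 2)))
    (hsum : δ < 1 ∨ Summable (fun n : admissible ν =>
        |∫ t, f t ∂(condGW ν (n : ℕ))| * ((n : ℕ) : ℝ) ^ (-(1 / 2) : ℝ))) :
    (fun n : ℕ => (∫ t, additive f t ∂(condGW ν n)) - (n : ℝ) * ∫ t, f t ∂(gwLaw ν))
      =O[admissibleAtTop ν] (fun n : ℕ => (n : ℝ) ^ ((1 - δ) / 2)) := by
  obtain ⟨K, κ, hK, hκ, hA, hb, hlow, hdiff⟩ :=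
    exists_walkProb_bounds ν hmean hvar_fin hvar_pos hδ hδ1 hmom
  have hgle : ∀ n ∈ admissible ν, |treeMean ν f n| ≤
      K * (n : ℝ) ^ (-(3 / 2) : ℝ) * |∫ t, f t ∂(condGW ν n)| := by
    intro n hn
    rw [treeMean_eq_mul ν f hn, abs_mul, abs_of_pos (treeMean_one_pos ν hn)]
    gcongr
    exact treeMean_one_le ν hb hn
  obtain ⟨B₁, hB₁, hg⟩ : ∃ B : ℝ, 0 ≤ B ∧ ∀ k : ℕ, 1 ≤ k →
      |treeMean ν f k| ≤ B * (k : ℝ) ^ (-(3 / 2) - δ / 2) := by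
    obtain ⟨E, hE0, hE⟩ := hO.exists_nonneg
    replace hE := hE.bound
    rw [admissibleAtTop, eventually_inf_principal] at hE
    have hO' : treeMean ν f =O[atTop] fun k : ℕ => (k : ℝ) ^ (-(3 / 2) - δ / 2) := by
      refine IsBigO.of_bound (K * E) ?_
      filter_upwards [hE, eventually_ge_atTop 1] with n hn hn1
      have hn0 : (0 : ℝ) < n := by exact_mod_cast hn1
      by_cases hna : n ∈ admissible ν
      · have e := hn hna
        have hp : 0 ≤ K * (n : ℝ) ^ (-(3 / 2) : ℝ) := by positivity
        refine (hgle n hna).trans ((mul_le_mul_of_nonneg_left e hp).trans_eq ?_)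
        rw [norm_of_nonneg (by positivity), norm_of_nonneg (by positivity),
          show -(3 / 2) - δ / 2 = -(3 / 2) + -δ / 2 by ring, rpow_add hn0]
        ring
      · rw [treeMean_eq_zero ν f hna, norm_zero]
        positivity
    obtain ⟨C, hC, h⟩ := bound_of_isBigO_nat_atTop hO'
    refine ⟨C, hC.le, fun k hk => ?_⟩
    have hk0 : (0 : ℝ) < k := by exact_mod_cast hk
    have := h (x := k) (by positivity)
    rwa [norm_eq_abs, norm_of_nonneg (by positivity)] at this
  obtain ⟨B₂, hB₂, hs⟩ : ∃ B : ℝ, 0 ≤ B ∧ ∀ n : ℕ, 1 ≤ n →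
      ∑ k ∈ Finset.range (n + 1), k * |treeMean ν f k| ≤ B * (n : ℝ) ^ ((1 - δ) / 2) := by
    rcases hsum with hδ' | hsum
    · have hs0 : 0 < (1 - δ) / 2 := by linarith
      refine ⟨B₁ / ((1 - δ) / 2), by positivity, fun n _ => ?_⟩
      rw [Finset.sum_range_succ']
      simp only [Nat.cast_zero, zero_mul, add_zero]
      calc ∑ k ∈ Finset.range n, ((k + 1 : ℕ) : ℝ) * |treeMean ν f (k + 1)|
          ≤ ∑ k ∈ Finset.range n, B₁ * ((k : ℝ) + 1) ^ ((1 - δ) / 2 - 1) := by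
            refine Finset.sum_le_sum fun k _ => ?_
            have hk0 : (0 : ℝ) < (k : ℝ) + 1 := by positivity
            have := mul_le_mul_of_nonneg_left (hg (k + 1) (by omega)) hk0.le
            push_cast at this ⊢
            refine this.trans_eq ?_
            rw [show (1 - δ) / 2 - 1 = 1 + (-(3 / 2) - δ / 2) by ring,
              rpow_one_add' hk0.le (by linarith)]
            ring
        _ ≤ B₁ * ((n : ℝ) ^ ((1 - δ) / 2) / ((1 - δ) / 2)) := by
            rw [← Finset.mul_sum]
            gcongr
            exact sum_range_rpow_le hs0 (by linarith) n
        _ = _ := by ring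
    · set u : ℕ → ℝ := (admissible ν).indicator
        fun n => |∫ t, f t ∂(condGW ν n)| * (n : ℝ) ^ (-(1 / 2) : ℝ) with hu
      have hus : Summable u := summable_subtype_iff_indicator.mp hsum
      have hu0 : ∀ k, 0 ≤ u k := fun k => Set.indicator_nonneg (fun k _ => by positivity) k
      have hU : 0 ≤ ∑' k, u k := tsum_nonneg hu0
      refine ⟨K * ∑' k, u k, by positivity, fun n hn => ?_⟩
      have hn1 : (1 : ℝ) ≤ n := by exact_mod_cast hn
      calc ∑ k ∈ Finset.range (n + 1), k * |treeMean ν f k|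
          ≤ ∑ k ∈ Finset.range (n + 1), K * u k := by
            refine Finset.sum_le_sum fun k _ => ?_
            by_cases hk : k ∈ admissible ν
            · have hk0 : (0 : ℝ) < k := by exact_mod_cast one_le_of_mem_admissible ν hk
              rw [hu, Set.indicator_of_mem hk]
              refine (mul_le_mul_of_nonneg_left (hgle k hk) hk0.le).trans_eq ?_
              have r : (k : ℝ) * (k : ℝ) ^ (-(3 / 2) : ℝ) = (k : ℝ) ^ (-(1 / 2) : ℝ) := by
                rw [← rpow_one_add' hk0.le (by norm_num)]; norm_num
              rw [← r]
              ring
            · rw [treeMean_eq_zero ν f hk, abs_zero, mul_zero]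
              exact mul_nonneg hK (hu0 k)
        _ ≤ K * ∑' k, u k := by
            rw [← Finset.mul_sum]
            gcongr
            exact hus.sum_le_tsum _ fun k _ => hu0 k
        _ ≤ _ := le_mul_of_one_le_right (by positivity)
            (one_le_rpow hn1 (by linarith))
  obtain ⟨D, hD⟩ := exists_abs_convolution_sub_le (S := admissible ν)
    (A := fun m => walkProb ν m m) (b := fun n => walkProb ν n (n - 1)) (B := max B₁ B₂)
    hδ hδ1 hK hκ (hB₁.trans (le_max_left _ _)) (fun n hn => one_le_of_mem_admissible ν hn)
    (fun m => walkProb_nonneg ν m m) (fun n => walkProb_nonneg ν n _) hA hb hlow hdiff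
    (fun k hk => treeMean_eq_zero ν f hk) (hasSum_treeMean ν f hf)
    (fun k hk => (hg k hk).trans (by gcongr; exact le_max_left _ _))
    (fun n hn => (hs n hn).trans (by gcongr; exact le_max_right _ _))
  refine IsBigO.of_bound D ?_
  rw [admissibleAtTop, eventually_inf_principal]
  filter_upwards [hD] with n hn hna
  rw [integral_additive_condGW ν f hna, norm_eq_abs, norm_of_nonneg (by positivity)]
  exact hn hna

end PlaneTree

theorem mainTheorem6 (ν : Measure ℕ) [IsProbabilityMeasure ν]
    (hmean : ∫ k, (k : ℝ) ∂ν = 1)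
    (hvar_fin : MemLp (fun k : ℕ => (k : ℝ)) 2 ν)
    (hvar_pos : 0 < variance (fun k : ℕ => (k : ℝ)) ν)
    (f : PlaneTree → ℝ)
    (hf : Integrable f (PlaneTree.gwLaw ν))
    (hf0 : Tendsto (fun n : ℕ => ∫ t, f t ∂(PlaneTree.condGW ν n))
      (PlaneTree.admissibleAtTop ν) (𝓝 0)) :
    (∀ δ : ℝ, 0 < δ → δ < 1 →
      Integrable (fun k : ℕ => (k : ℝ) ^ (2 + δ)) ν →
      (fun n : ℕ => ∫ t, f t ∂(PlaneTree.condGW ν n))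
        =O[PlaneTree.admissibleAtTop ν] (fun n : ℕ => (n : ℝ) ^ (-δ / 2)) →
      (fun n : ℕ => (∫ t, PlaneTree.additive f t ∂(PlaneTree.condGW ν n))
          - (n : ℝ) * ∫ t, f t ∂(PlaneTree.gwLaw ν))
        =O[PlaneTree.admissibleAtTop ν] (fun n : ℕ => (n : ℝ) ^ ((1 - δ) / 2))) ∧
    (Integrable (fun k : ℕ => (k : ℝ) ^ 3) ν →
      (fun n : ℕ => ∫ t, f t ∂(PlaneTree.condGW ν n))
        =O[PlaneTree.admissibleAtTop ν] (fun n : ℕ => (n : ℝ) ^ (-(1 / 2) : ℝ)) →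
      Summable (fun n : PlaneTree.admissible ν =>
        |∫ t, f t ∂(PlaneTree.condGW ν (n : ℕ))| * ((n : ℕ) : ℝ) ^ (-(1 / 2) : ℝ)) →
      (fun n : ℕ => (∫ t, PlaneTree.additive f t ∂(PlaneTree.condGW ν n))
          - (n : ℝ) * ∫ t, f t ∂(PlaneTree.gwLaw ν))
        =O[PlaneTree.admissibleAtTop ν] (fun _ : ℕ => (1 : ℝ))) := by
  refine ⟨fun δ hδ hδ1 hmom hO => ?_, fun hmom hO hsum => ?_⟩
  · exact PlaneTree.isBigO_integral_additive_sub ν hmean hvar_fin hvar_pos f hf hδ hδ1.le hmom hO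
      (Or.inl hδ1)
  · have hmom' : Integrable (fun k : ℕ => (k : ℝ) ^ ((2 : ℝ) + 1)) ν := by
      refine hmom.congr (Eventually.of_forall fun k => ?_)
      simp only
      rw [show (2 : ℝ) + 1 = ((3 : ℕ) : ℝ) by norm_num, Real.rpow_natCast]
    have hO' : (fun n : ℕ => ∫ t, f t ∂(PlaneTree.condGW ν n))
        =O[PlaneTree.admissibleAtTop ν] (fun n : ℕ => (n : ℝ) ^ (-(1 : ℝ) / 2)) := by
      simpa only [neg_div] using hO
    simpa using PlaneTree.isBigO_integral_additive_sub ν hmean hvar_fin hvar_pos f hf one_pos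
      le_rfl hmom' hO' (Or.inr hsum)
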